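/- **Setting.** Let $1\le d\le N$ be integers (in particular $N\ge 1$), $n=\lceil\log_2 N\rceil$, and label rows and columns by $0,\dots,N-1$. A matrix $A\in\mathbb C^{N\times N}$ is *$d$-sparse* if each row and each column has at most $d$ non-zero entries; a Hermitian $A$ is *diagonally dominant* if $\sum_{j\ne i}|A_{ij}|\le |A_{ii}|$ for all $i$. A *sparse-matrix oracle* for $A$ is a pair of reversible operations with $$\mathcal P^{pos}_A:|i,\nu\rangle\mapsto|i,j(i,\nu)\rangle,\qquad \mathcal P^{val}_A:|i,j,z\rangle\mapsto|i,j,z+A_{ij}\rangle\qquad(0\le i,j<N,\ 0\le\nu<d),$$ where for each $i$ the list $j(i,0),\dots,j(i,d-1)$ of elements of $\{0,\dots,N-1\}$ contains the positions of all non-zero entries of row $i$; nothing is assumed on other inputs. *Cost model.* Memory consists of $n$-qubit index registers, single qubits, and registers holding exact complex numbers. The query complexity of a circuit is the number of calls to $\mathcal P^{pos}_A,\mathcal P^{val}_A$ and their inverses; its gate complexity is the number of all other gates, where each of the following is one gate: an exact single-qubit unitary; a controlled-not or Toffoli gate; an exact controlled rotation or phase rotation of a qubit by an angle stored in a number register;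 a reversible elementary operation on $O(1)$ index registers (adding a constant, addition, controlled addition, swap, comparison); a reversible elementary arithmetic operation on $O(1)$ number registers (adding a rational constant or a bit, copy, $+,-,\times,\div$, conjugate, modulus, square root, $\arccos$, argument). (So single-qubit rotations are exact and arithmetic uses a constant number of digits, i.e. unit cost, without rounding.) A unitary $U$ on $n+a$ qubits is an $(\alpha,a,\varepsilon)$*-block-encoding* of an $n$-qubit operator $M$ if $\|M-\alpha(\langle 0^a|\otimes I)U(|0^a\rangle\otimes I)\|\le\varepsilon$, and *normalised* if $\alpha=1$; a circuit implementing $U$ may use further ancillas that are zero before and after. **Proposition.** There is an absolute constant $C$ such that for all $1\le d\le N$ there are circuits $c_L,c_R,c$, depending only on $N$ and $d$, each of query complexity at most $Cd$ and gate complexity at most $Cd$, with the following property. Let $A\in\mathbb C^{N\times N}$ be positive definite, $d$-sparse and diagonally dominant with $A_{ii}\le 1$ for all $i$. When run with any sparse-matrix oracle for $A$, the circuits $c_L$, $c_R$, $c$ implement unitaries $U_L$, $U_R$ and $U_L^\dagger U_R$ on $n+(n+2)$ qubits such that 1. for all $i,j\in\{0,\dots,N-1\}$, $U_L:|0^{n+2}\rangle|i\rangle\mapsto|i\rangle|\psi_i^*\rangle$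 and $U_R:|0^{n+2}\rangle|j\rangle\mapsto|\phi_j\rangle|j\rangle$, where (principal square roots; $*$ is complex conjugation; $|\bot\rangle$ is an additional basis state orthogonal to all $|l\rangle$, $l<N$, of an $(n+1)$-qubit register) $$|\psi_i\rangle=\sum_{l:\,A_{il}\neq0}\sqrt{\delta_{il}-A_{il}}\,|l\rangle+\sqrt{r_i}\,|\bot\rangle,\quad |\phi_j\rangle=\sum_{k:\,A_{jk}\neq0}\sqrt{\delta_{jk}-A_{jk}^*}\,|k\rangle+\sqrt{r_j}\,|\bot\rangle,\quad r_i=A_{ii}-\sum_{l\ne i}|A_{il}|;$$ 2. $U_L^\dagger U_R$ is a $(1,n+2,0)$-block-encoding, i.e. an exact normalised block-encoding, of $B=I-A$ (padded with zeroes to an $n$-qubit operator if $N<2^n$). -/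

import Mathlib

open scoped Matrix ComplexOrder

noncomputable section

namespace PDQLS

/-! ### The matrices -/

/-- At most `d` non-zero entries in each row and each column. -/
def IsSparse {N : ℕ} (d : ℕ) (A : Matrix (Fin N) (Fin N) ℂ) : Prop :=
  (∀ i, {j | A i j ≠ 0}.ncard ≤ d) ∧ (∀ j, {i | A i j ≠ 0}.ncard ≤ d)

/-- Diagonal dominance (of a Hermitian matrix), not necessarily strict. -/
def IsDiagDominant {N : ℕ} (A : Matrix (Fin N) (Fin N) ℂ) : Prop :=
  ∀ i, ∑ j ∈ Finset.univ.erase i, ‖A i j‖ ≤ ‖A i i‖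

/-! ### Words, memory, oracles

An `n`-qubit register has the computational basis `Fin (2 ^ n)`, the integers being written in
binary.  The row/column label `i ∈ {0, …, N - 1}` and the counter `ν ∈ {0, …, d - 1}` are stored as
the words `word n i`, `word n ν`. -/

/-- Basis states of an `n`-qubit index register. -/
abbrev Word (n : ℕ) : Type := Fin (2 ^ n)

/-- The binary representation of `i` (only used for `i < 2 ^ n`). -/
def word (n i : ℕ) : Word n := Fin.ofNat (2 ^ n) i

/-- A computational basis state of the whole memory: index registers of `n` qubits each,
single qubits, and registers that hold (an exact representation of) a complex number.  There is an
unlimited supply of registers of each kind; a circuit touches finitely many of them. -/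
@[ext]
structure Mem (n : ℕ) where
  idx : ℕ → Word n
  bit : ℕ → Bool
  num : ℕ → ℂ

/-- A pair of black-box reversible operations with the types of a sparse-matrix oracle. -/
structure Oracle (n : ℕ) where
  pos : Equiv.Perm (Word n × Word n)
  val : Equiv.Perm (Word n × Word n × ℂ)

/-- `O` is a sparse-matrix-access for `A` with sparsity `d`:
`pos : |i, ν⟩ ↦ |i, j(i, ν)⟩`, where `j(i, 0), …, j(i, d - 1)` contains the positions of all non-zero
entries of row `i`, and `val : |i, j, z⟩ ↦ |i, j, z + A i j⟩`.  Nothing is required of the oracles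
on words that are not such labels.  (Since `pos` is a permutation, `j(i, ·)` is injective.) -/
def IsSparseAccess {n N : ℕ} (O : Oracle n) (A : Matrix (Fin N) (Fin N) ℂ) (d : ℕ) : Prop :=
  (∃ j : Fin N → Fin d → Fin N,
    (∀ (i : Fin N) (ν : Fin d), O.pos (word n i, word n ν) = (word n i, word n (j i ν))) ∧
    ∀ i l, A i l ≠ 0 → ∃ ν, j i ν = l) ∧
  ∀ (i j : Fin N) (z : ℂ), O.val (word n i, word n j, z) = (word n i, word n j, z + A i j)

/-! ### Elementary gates -/

/-- Binary arithmetic operations. -/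
inductive BinOp
  | add | sub | mul | div

def BinOp.eval : BinOp → ℂ → ℂ → ℂ
  | add, x, y => x + y
  | sub, x, y => x - y
  | mul, x, y => x * y
  | div, x, y => x / y

/-- Unary arithmetic operations. -/
inductive UnOp
  | copy | conj | abs | sqrt | arccos | arg

def UnOp.eval : UnOp → ℂ → ℂ
  | copy, x => x
  | conj, x => (starRingEnd ℂ) x
  | abs, x => (‖x‖ : ℝ)
  | sqrt, x => Complex.sqrt x
  | arccos, x => (Real.arccos x.re : ℝ)
  | arg, x => (Complex.arg x : ℝ)

/-- The gate set.  `pos` and `val` are the oracle queries; every other gate acts on at most three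
registers.  Arithmetic on index words and on numbers is reversible: the result is added to, or
(`inv = true`) subtracted from, a target register distinct from the arguments.  The side conditions
say that registers which have to be distinct are distinct. -/
inductive Gate (n : ℕ)
  /-- query of the position oracle, or of its inverse, on the index registers `r`, `s` -/
  | pos (inv : Bool) (r s : ℕ) (h : r ≠ s)
  /-- query of the value oracle, or of its inverse, on `r`, `s` and the number register `t` -/
  | val (inv : Bool) (r s t : ℕ) (h : r ≠ s)
  /-- an arbitrary, exact, single-qubit unitary -/
  | single (b : ℕ) (U : Matrix.unitaryGroup Bool ℂ)
  /-- controlled-not -/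
  | cnot (c b : ℕ) (h : c ≠ b)
  /-- Toffoli gate -/
  | toffoli (c c' b : ℕ) (h : c ≠ b) (h' : c' ≠ b)
  /-- add a constant to an index register -/
  | idxConst (w : Word n) (t : ℕ)
  /-- add the index register `s` to `t` -/
  | idxAdd (inv : Bool) (s t : ℕ) (h : s ≠ t)
  /-- the same, controlled on the qubit `c` -/
  | cIdxAdd (inv : Bool) (c s t : ℕ) (h : s ≠ t)
  /-- swap two index registers -/
  | idxSwap (s t : ℕ)
  /-- flip the qubit `b` if the index registers `r`, `s` are equal -/
  | idxEq (r s b : ℕ)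
  /-- flip the qubit `b` if `r < s` -/
  | idxLt (r s b : ℕ)
  /-- add a rational constant to a number register -/
  | numConst (q : ℚ) (t : ℕ)
  /-- add the bit `b`, as a number, to a number register -/
  | numBit (inv : Bool) (b t : ℕ)
  /-- unary arithmetic -/
  | numUn (inv : Bool) (f : UnOp) (s t : ℕ) (h : s ≠ t)
  /-- binary arithmetic -/
  | numBin (inv : Bool) (f : BinOp) (s s' t : ℕ) (h : s ≠ t) (h' : s' ≠ t)
  /-- on the qubit `b`, controlled on `c`: exact rotation by the angle in the number register `s` -/
  | cRot (c s b : ℕ) (h : c ≠ b)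
  /-- on the qubit `b`, controlled on `c`: exact phase rotation by the angle in `s` -/
  | cPhase (c s b : ℕ) (h : c ≠ b)

/-- `rotation θ` maps `|0⟩` to `cos θ |0⟩ + sin θ |1⟩` and `|1⟩` to `- sin θ |0⟩ + cos θ |1⟩`. -/
def rotation (θ : ℝ) : Matrix Bool Bool ℂ
  | false, false => Real.cos θ
  | true, false => Real.sin θ
  | false, true => -Real.sin θ
  | true, true => Real.cos θ

/-- `phase θ` maps `|0⟩` to `|0⟩` and `|1⟩` to `e^{iθ} |1⟩`. -/
def phase (θ : ℝ) : Matrix Bool Bool ℂ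
  | false, false => 1
  | true, true => Complex.exp (θ * Complex.I)
  | _, _ => 0

variable {n : ℕ}

/-- (Finite) superpositions of basis states of the memory. -/
abbrev State (n : ℕ) : Type := Mem n →₀ ℂ

/-- `|x⟩` -/
def ket (x : Mem n) : State n := Finsupp.single x 1

/-- Replace the contents of one register. -/
def Mem.setIdx (x : Mem n) (t : ℕ) (w : Word n) : Mem n := { x with idx := Function.update x.idx t w }

def Mem.setBit (x : Mem n) (t : ℕ) (b : Bool) : Mem n := { x with bit := Function.update x.bit t b }

def Mem.setNum (x : Mem n) (t : ℕ) (z : ℂ) : Mem n := { x with num := Function.update x.num t z }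

/-- Addition or subtraction, according to the flag `inv`. -/
def addOrSub {R : Type} [Add R] [Sub R] (inv : Bool) (x y : R) : R := if inv then x - y else x + y

/-- A permutation or its inverse, according to the flag `inv`. -/
def fwdOrInv {R : Type} (inv : Bool) (e : Equiv.Perm R) : Equiv.Perm R := if inv then e.symm else e

/-- The matrix `M` applied to the qubit `b` of `|x⟩`. -/
def applyQubit (M : Matrix Bool Bool ℂ) (b : ℕ) (x : Mem n) : State n :=
  ∑ o : Bool, M o (x.bit b) • ket (x.setBit b o)

/-- Action of a gate on a basis state. -/
def Gate.onBasis (O : Oracle n) : Gate n → Mem n → State n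
  | pos inv r s _, x =>
      let y := fwdOrInv inv O.pos (x.idx r, x.idx s)
      ket ((x.setIdx r y.1).setIdx s y.2)
  | val inv r s t _, x =>
      let y := fwdOrInv inv O.val (x.idx r, x.idx s, x.num t)
      ket (((x.setIdx r y.1).setIdx s y.2.1).setNum t y.2.2)
  | single b U, x => applyQubit U.1 b x
  | cnot c b _, x => ket (x.setBit b (x.bit b ^^ x.bit c))
  | toffoli c c' b _ _, x => ket (x.setBit b (x.bit b ^^ (x.bit c && x.bit c')))
  | idxConst w t, x => ket (x.setIdx t (x.idx t + w))
  | idxAdd inv s t _, x => ket (x.setIdx t (addOrSub inv (x.idx t) (x.idx s)))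
  | cIdxAdd inv c s t _, x =>
      ket (if x.bit c then x.setIdx t (addOrSub inv (x.idx t) (x.idx s)) else x)
  | idxSwap s t, x => ket ((x.setIdx s (x.idx t)).setIdx t (x.idx s))
  | idxEq r s b, x => ket (x.setBit b (x.bit b ^^ decide (x.idx r = x.idx s)))
  | idxLt r s b, x => ket (x.setBit b (x.bit b ^^ decide (x.idx r < x.idx s)))
  | numConst q t, x => ket (x.setNum t (x.num t + (q : ℂ)))
  | numBit inv b t, x => ket (x.setNum t (addOrSub inv (x.num t) (if x.bit b then 1 else 0)))
  | numUn inv f s t _, x => ket (x.setNum t (addOrSub inv (x.num t) (f.eval (x.num s))))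
  | numBin inv f s s' t _ _, x =>
      ket (x.setNum t (addOrSub inv (x.num t) (f.eval (x.num s) (x.num s'))))
  | cRot c s b _, x => if x.bit c then applyQubit (rotation (x.num s).re) b x else ket x
  | cPhase c s b _, x => if x.bit c then applyQubit (phase (x.num s).re) b x else ket x

/-! ### Circuits and their cost -/

/-- A circuit is a sequence of gates, the first one being applied first. -/
abbrev Circuit (n : ℕ) : Type := List (Gate n)

def Gate.isQuery : Gate n → Bool
  | pos .. => true
  | val .. => true
  | _ => false

/-- Query complexity: the number of calls to the oracles and their inverses. -/
def Circuit.queries (c : Circuit n) : ℕ := c.countP (fun g => g.isQuery)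

/-- Gate complexity: the number of gates that are not queries. -/
def Circuit.gates (c : Circuit n) : ℕ := c.countP (fun g => !g.isQuery)

/-- The linear operator that a circuit realises on superpositions. -/
def Circuit.run (O : Oracle n) : Circuit n → State n →ₗ[ℂ] State n
  | [] => LinearMap.id
  | g :: c => (Circuit.run O c).comp (Finsupp.linearCombination ℂ (g.onBasis O))

/-! ### The qubits on which the block-encoding acts

The block-encoding acts on two registers of `n + 1` qubits.  Such a register holds a label
`l ∈ {0, …, N - 1}`, or the additional label "`N + 1`".  The `n` system qubits are the index part of the
first register; the other `n + 2` qubits are the ancillas on which one post-selects. -/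

/-- Basis states of a register of `n + 1` qubits. -/
abbrev Label (n : ℕ) : Type := Word n × Bool

/-- The basis state `|l⟩` with `l < N`. -/
def label (n l : ℕ) : Label n := (word n l, false)

/-- The additional basis state, orthogonal to all `|l⟩`. -/
def lastLabel (n : ℕ) : Label n := (word n 0, true)

/-- Basis states of the `n + 2` post-selected ancilla qubits: the additional qubit of the first
register, and the second register. -/
abbrev Anc (n : ℕ) : Type := Bool × Label n

/-- The ancilla state `|0^a⟩`. -/
def ancZero (n : ℕ) : Anc n := (false, word n 0, false)

/-- Contents of the first and of the second register. -/
def reg₁ (x : Anc n × Word n) : Label n := (x.2, x.1.1)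

def reg₂ (x : Anc n × Word n) : Label n := x.1.2

/-- The memory in which the two registers occupy index registers 0, 1 and qubits 0, 1 and everything
else is zero. -/
def load (x : Anc n × Word n) : Mem n where
  idx k := if k = 0 then (reg₁ x).1 else if k = 1 then (reg₂ x).1 else word n 0
  bit k := if k = 0 then (reg₁ x).2 else if k = 1 then (reg₂ x).2 else false
  num _ := 0

/-- With oracle `O`, the circuit `c` implements the operator `U` on the `n + (n + 2)` qubits; all
further registers are zero before and after. -/
def Implements (O : Oracle n) (c : Circuit n) (U : Matrix (Anc n × Word n) (Anc n × Word n) ℂ) :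
    Prop :=
  ∀ x, c.run O (ket (load x)) = ∑ y, U y x • ket (load y)

/-- `U` is an `(α, a, ε)`-matrix-block-encoding of the `n`-qubit operator `M`: it is unitary on `n + a`
qubits, where `𝒜` labels the basis of the `a` ancilla qubits and `z` is their state `|0^a⟩`, and
`‖M - α (⟨0^a| ⊗ I) U (|0^a⟩ ⊗ I)‖ ≤ ε` in the operator norm. -/
def IsBlockEncoding {𝒜 : Type} [Fintype 𝒜] [DecidableEq 𝒜] (α : ℝ) (a : ℕ) (ε : ℝ) (z : 𝒜)
    (U : Matrix (𝒜 × Word n) (𝒜 × Word n) ℂ) (M : Matrix (Word n) (Word n) ℂ) : Prop :=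
  Fintype.card 𝒜 = 2 ^ a ∧
  U ∈ Matrix.unitaryGroup (𝒜 × Word n) ℂ ∧
  ‖Matrix.toEuclideanCLM (𝕜 := ℂ)
    (M - (α : ℂ) • Matrix.of fun i j => U (z, i) (z, j))‖ ≤ ε

/-- An `N × N` matrix as an `n`-qubit operator, padded with zeroes. -/
def padded {N : ℕ} (n : ℕ) (B : Matrix (Fin N) (Fin N) ℂ) : Matrix (Word n) (Word n) ℂ :=
  Matrix.of fun x y => if h : x.val < N ∧ y.val < N then B ⟨x, h.1⟩ ⟨y, h.2⟩ else 0

/-! ### The states -/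

/-- `r_i = A_ii - ∑_{l ≠ i} |A_il|` -/
def rest {N : ℕ} (A : Matrix (Fin N) (Fin N) ℂ) (i : Fin N) : ℝ :=
  (A i i).re - ∑ l ∈ Finset.univ.erase i, ‖A i l‖

open Classical in
/-- `|ψ_i⟩ = ∑_{l ∈ supp A_i} √(δ_il - A_il) |l⟩ + √r_i |N+1⟩` -/
def psi {N : ℕ} (n : ℕ) (A : Matrix (Fin N) (Fin N) ℂ) (i : Fin N) : Label n → ℂ :=
  (∑ l with A i l ≠ 0, Complex.sqrt ((if i = l then 1 else 0) - A i l) • Pi.single (label n l) 1)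
    + ((√(rest A i) : ℝ) : ℂ) • Pi.single (lastLabel n) 1

open Classical in
/-- `|φ_j⟩ = ∑_{k ∈ supp A_j} √(δ_jk - A_jk^*) |k⟩ + √r_j |N+1⟩` -/
def phi {N : ℕ} (n : ℕ) (A : Matrix (Fin N) (Fin N) ℂ) (j : Fin N) : Label n → ℂ :=
  (∑ k with A j k ≠ 0,
      Complex.sqrt ((if j = k then 1 else 0) - (starRingEnd ℂ) (A j k)) • Pi.single (label n k) 1)
    + ((√(rest A j) : ℝ) : ℂ) • Pi.single (lastLabel n) 1

/-- `U : |0^a⟩|i⟩ ↦ |i⟩|ψ_i^*⟩` for all `i < N` -/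
def PreparesLeft {N : ℕ} (A : Matrix (Fin N) (Fin N) ℂ)
    (U : Matrix (Anc n × Word n) (Anc n × Word n) ℂ) : Prop :=
  ∀ (i : Fin N) (y : Anc n × Word n), U y (ancZero n, word n i) =
    (if reg₁ y = label n i then 1 else 0) * (starRingEnd ℂ) (psi n A i (reg₂ y))

/-- `U : |0^a⟩|j⟩ ↦ |φ_j⟩|j⟩` for all `j < N` -/
def PreparesRight {N : ℕ} (A : Matrix (Fin N) (Fin N) ℂ)
    (U : Matrix (Anc n × Word n) (Anc n × Word n) ℂ) : Prop :=
  ∀ (j : Fin N) (y : Anc n × Word n), U y (ancZero n, word n j) =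
    phi n A j (reg₁ y) * (if reg₂ y = label n j then 1 else 0)

end PDQLS

end

noncomputable section

namespace PDQLS

variable {n : ℕ}

/-! ### Reading and writing registers -/

/-! The algebra is short. The only basis vector that can occur in both $|i\rangle|\psi_i^*\rangle$
and $|\phi_j\rangle|j\rangle$ is $|i\rangle|j\rangle$, so the $(i,j)$ entry of the block of
$U_L^\dagger U_R$ is $\psi_i(j)\,\phi_j(i)$. As $A$ is Hermitian, both factors are the same square
root of $\delta_{ij}-A_{ij}$ (`isBlockEncoding_of_rowStates`). The states are normalised since
$A_{ii}\le 1$ gives $\sum_l|\delta_{il}-A_{il}|=1-r_i$ (`sum_norm_sub`), and dominance gives $r_i\ge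
0$.

The work lies in preparing a row exactly with $O(d)$ gates. All the weight starts in
$|0\rangle|0\rangle$ (word and flag). For each listed position $p$ with entry $\alpha$, a rotation
in the plane of $|0\rangle|0\rangle$ and $|p\rangle|1\rangle$ splits the remaining amplitude $\sqrt
S$ into $\sqrt{S-t}$, which stays, and the amplitude of modulus $\sqrt t$ deposited at $p$, where
$t=|\delta-\alpha|$ (`run_stepCircuit`). Distinct positions leave earlier deposits untouched
(`run_steps_zero`). Since $S$ depends on the row alone, it is kept in a number register, and a
second pass over the row restores it.

Non-labels are replaced by $0$, so that the oracles are queried only where they are specified. The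
circuit then preserves the finite-dimensional span of the memories with clean scratch. Being an
isometry, it acts there as a unitary, whose adjoint is implemented by the reversed circuit
(`exists_unitary_implements`). Phases are built from rotations, which have short inverses. -/

@[simp] lemma idx_setIdx (x : Mem n) (s t : ℕ) (w : Word n) :
    (x.setIdx t w).idx s = if s = t then w else x.idx s := by
  simp [Mem.setIdx, Function.update_apply]

@[simp] lemma bit_setIdx (x : Mem n) (t : ℕ) (w : Word n) : (x.setIdx t w).bit = x.bit := rfl

@[simp] lemma num_setIdx (x : Mem n) (t : ℕ) (w : Word n) : (x.setIdx t w).num = x.num := rfl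

@[simp] lemma bit_setBit (x : Mem n) (s t : ℕ) (b : Bool) :
    (x.setBit t b).bit s = if s = t then b else x.bit s := by
  simp [Mem.setBit, Function.update_apply]

@[simp] lemma idx_setBit (x : Mem n) (t : ℕ) (b : Bool) : (x.setBit t b).idx = x.idx := rfl

@[simp] lemma num_setBit (x : Mem n) (t : ℕ) (b : Bool) : (x.setBit t b).num = x.num := rfl

@[simp] lemma num_setNum (x : Mem n) (s t : ℕ) (z : ℂ) :
    (x.setNum t z).num s = if s = t then z else x.num s := by
  simp [Mem.setNum, Function.update_apply]

@[simp] lemma idx_setNum (x : Mem n) (t : ℕ) (z : ℂ) : (x.setNum t z).idx = x.idx := rfl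

@[simp] lemma bit_setNum (x : Mem n) (t : ℕ) (z : ℂ) : (x.setNum t z).bit = x.bit := rfl

lemma setIdx_eq_self {x : Mem n} {t : ℕ} {w : Word n} (h : x.idx t = w) : x.setIdx t w = x := by
  subst h; simp [Mem.setIdx]

lemma setBit_eq_self {x : Mem n} {t : ℕ} {b : Bool} (h : x.bit t = b) : x.setBit t b = x := by
  subst h; simp [Mem.setBit]

lemma setNum_eq_self {x : Mem n} {t : ℕ} {z : ℂ} (h : x.num t = z) : x.setNum t z = x := by
  subst h; simp [Mem.setNum]

@[simp] lemma setIdx_setIdx (x : Mem n) (t : ℕ) (w w' : Word n) :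
    (x.setIdx t w).setIdx t w' = x.setIdx t w' := by
  simp [Mem.setIdx]

@[simp] lemma setBit_setBit (x : Mem n) (t : ℕ) (b b' : Bool) :
    (x.setBit t b).setBit t b' = x.setBit t b' := by
  simp [Mem.setBit]

@[simp] lemma setNum_setNum (x : Mem n) (t : ℕ) (z z' : ℂ) :
    (x.setNum t z).setNum t z' = x.setNum t z' := by
  simp [Mem.setNum]

/-! ### Running circuits -/

@[simp] lemma run_nil (O : Oracle n) (v : State n) : Circuit.run O [] v = v := rfl

lemma run_cons_ket (O : Oracle n) (g : Gate n) (c : Circuit n) (x : Mem n) :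
    Circuit.run O (g :: c) (ket x) = Circuit.run O c (g.onBasis O x) := by
  simp [Circuit.run, ket]

lemma run_cons (O : Oracle n) (g : Gate n) (c : Circuit n) (v : State n) :
    Circuit.run O (g :: c) v = Circuit.run O c (Circuit.run O [g] v) := by
  simp [Circuit.run]

lemma run_append (O : Oracle n) (c c' : Circuit n) (v : State n) :
    Circuit.run O (c ++ c') v = Circuit.run O c' (Circuit.run O c v) := by
  induction c generalizing v with
  | nil => rfl
  | cons g c ih => rw [List.cons_append, run_cons, ih, ← run_cons]

lemma linearMap_ext_ket {V : Type*} [AddCommGroup V] [Module ℂ V] {f g : State n →ₗ[ℂ] V}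
    (h : ∀ x, f (ket x) = g (ket x)) : f = g :=
  Finsupp.lhom_ext fun x a => by
    have : (Finsupp.single x a : State n) = a • ket x := by simp [ket]
    rw [this, map_smul, map_smul, h]

/-! ### The inner product of superpositions -/

/-- `⟨v|w⟩` -/
def braket (v w : State n) : ℂ := v.sum fun x a => (starRingEnd ℂ) a * w x

lemma braket_add_left (u v w : State n) : braket (u + v) w = braket u w + braket v w := by
  unfold braket
  exact Finsupp.sum_add_index' (by simp) (by intros; simp [add_mul])

lemma braket_smul_left (a : ℂ) (v w : State n) :
    braket (a • v) w = (starRingEnd ℂ) a * braket v w := by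
  unfold braket
  rw [Finsupp.sum_smul_index (by simp), Finsupp.mul_sum]
  simp [mul_assoc]

lemma braket_add_right (u v w : State n) : braket u (v + w) = braket u v + braket u w := by
  simp [braket, mul_add, Finsupp.sum_add]

lemma braket_smul_right (a : ℂ) (v w : State n) : braket v (a • w) = a * braket v w := by
  unfold braket
  rw [Finsupp.mul_sum]
  refine Finsupp.sum_congr fun x _ => ?_
  simp only [Finsupp.smul_apply, smul_eq_mul]; ring

@[simp] lemma braket_zero_left (w : State n) : braket 0 w = 0 := by simp [braket]

@[simp] lemma braket_zero_right (w : State n) : braket w 0 = 0 := by simp [braket]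

lemma braket_ket_left (x : Mem n) (w : State n) : braket (ket x) w = w x := by
  simp [braket, ket]

open Classical in
lemma braket_ket_ket (x y : Mem n) : braket (ket x) (ket y) = if x = y then 1 else 0 := by
  rw [braket_ket_left, ket, Finsupp.single_apply]
  simp [eq_comm]

lemma braket_sum_left {ι : Type*} (s : Finset ι) (v : ι → State n) (w : State n) :
    braket (∑ i ∈ s, v i) w = ∑ i ∈ s, braket (v i) w :=
  map_sum (AddMonoidHom.mk' (fun v => braket v w) fun u v => braket_add_left u v w) v s

lemma braket_sum_right {ι : Type*} (s : Finset ι) (v : ι → State n) (w : State n) :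
    braket w (∑ i ∈ s, v i) = ∑ i ∈ s, braket w (v i) :=
  map_sum (AddMonoidHom.mk' (fun v => braket w v) fun u v => braket_add_right w u v) v s

lemma isometry_of_ket (T : State n →ₗ[ℂ] State n)
    (h : ∀ x y, braket (T (ket x)) (T (ket y)) = braket (ket x) (ket y)) (v w : State n) :
    braket (T v) (T w) = braket v w := by
  have key (x : Mem n) (a : ℂ) : (Finsupp.single x a : State n) = a • ket x := by simp [ket]
  induction v using Finsupp.induction_linear with
  | zero => simp
  | add u v hu hv => rw [map_add, braket_add_left, braket_add_left, hu, hv]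
  | single x a =>
    rw [key, map_smul, braket_smul_left, braket_smul_left]
    congr 1
    induction w using Finsupp.induction_linear with
    | zero => simp
    | add u v hu hv => rw [map_add, braket_add_right, braket_add_right, hu, hv]
    | single y b => rw [key, map_smul, braket_smul_right, braket_smul_right, h]

/-! ### One-qubit operators -/

lemma conjTranspose_rotation_mul_self (θ : ℝ) : (rotation θ)ᴴ * rotation θ = 1 := by
  have h := congrArg (Complex.ofReal) (Real.sin_sq_add_cos_sq θ)
  push_cast at h
  ext i j
  cases i <;> cases j <;>
    simp [Matrix.mul_apply, rotation, Matrix.conjTranspose_apply, - Complex.ofReal_sin,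
      - Complex.ofReal_cos, Complex.conj_ofReal] <;> push_cast <;> first | ring1 | linear_combination h

/-- The Pauli matrix `Z`. -/
def pauliZ : Matrix.unitaryGroup Bool ℂ :=
  ⟨Matrix.diagonal fun b => if b then -1 else 1, by
    rw [Matrix.mem_unitaryGroup_iff, Matrix.star_eq_conjTranspose, Matrix.diagonal_conjTranspose,
      Matrix.diagonal_mul_diagonal, ← Matrix.diagonal_one]
    congr 1; funext b; cases b <;> simp⟩

/-- Conjugation by $Z$ flips the off-diagonal signs. This inverts a rotation without negating the
register that holds its angle. -/
lemma pauliZ_conj_rotation (θ : ℝ) : pauliZ.1 * rotation θ * pauliZ.1 = (rotation θ)ᴴ := by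
  ext i j
  cases i <;> cases j <;> simp [pauliZ, rotation, Matrix.conjTranspose_apply, - Complex.ofReal_sin,
    - Complex.ofReal_cos, Complex.conj_ofReal]

lemma pauliZ_mul_self : pauliZ.1 * pauliZ.1 = 1 := by
  rw [pauliZ, Matrix.diagonal_mul_diagonal, ← Matrix.diagonal_one]
  congr 1; funext b; cases b <;> simp

lemma applyQubit_one (b : ℕ) (x : Mem n) : applyQubit 1 b x = ket x := by
  have : x.setBit b (x.bit b) = x := setBit_eq_self rfl
  rw [applyQubit, Finset.sum_eq_single (x.bit b)]
  · simp [this]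
  · intro o _ ho; simp [Matrix.one_apply_ne ho]
  · simp

/-- A gate that acts on the qubit `b` by the matrix `M'`, applied after `M`. -/
lemma run_applyQubit (O : Oracle n) {g : Gate n} {b : ℕ} {x : Mem n} {M' : Matrix Bool Bool ℂ}
    (h : ∀ o, g.onBasis O (x.setBit b o) = applyQubit M' b (x.setBit b o))
    (M : Matrix Bool Bool ℂ) :
    Circuit.run O [g] (applyQubit M b x) = applyQubit (M' * M) b x := by
  rw [applyQubit, map_sum]
  simp_rw [map_smul, run_cons_ket, run_nil, h, applyQubit, Matrix.mul_apply, bit_setBit,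
    setBit_setBit, if_true, Finset.smul_sum, Finset.sum_smul, smul_smul]
  rw [Finset.sum_comm]
  simp_rw [mul_comm]

-- The image of a basis state lies in the span of the two memories that agree with it outside the
-- qubit `b`. Two such spans are orthogonal or equal, and in the second case the claim is the
-- orthonormality of the columns of `M`.
open Classical in
lemma braket_applyQubit {M : Matrix Bool Bool ℂ} (hM : Mᴴ * M = 1) (b : ℕ) (x y : Mem n) :
    braket (applyQubit M b x) (applyQubit M b y) = braket (ket x) (ket y) := by
  simp_rw [applyQubit, braket_sum_left, braket_sum_right, braket_smul_left, braket_smul_right,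
    braket_ket_ket]
  by_cases h : x.setBit b false = y.setBit b false
  · have hiff (o o' : Bool) : x.setBit b o = y.setBit b o' ↔ o = o' := by
      refine ⟨fun h => by simpa using congrArg (fun z => z.bit b) h, ?_⟩
      rintro rfl
      simpa using congrArg (fun z => z.setBit b o) h
    have h1 := congrFun (congrFun hM (x.bit b)) (y.bit b)
    rw [Matrix.mul_apply] at h1
    simp only [Matrix.conjTranspose_apply] at h1
    simp only [hiff, mul_ite, mul_one, mul_zero, Finset.sum_ite_eq, Finset.mem_univ, if_true]
    rw [if_congr (show x = y ↔ x.bit b = y.bit b from ⟨fun hb => by rw [hb], fun hb => ?_⟩) rfl rfl,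
      ← Matrix.one_apply, ← h1]
    · refine Finset.sum_congr rfl fun o _ => ?_
      rfl
    · have := congrArg (fun z => z.setBit b (x.bit b)) h
      simp only [setBit_setBit] at this
      rwa [setBit_eq_self rfl, setBit_eq_self hb.symm] at this
  · have hiff (o o' : Bool) : x.setBit b o ≠ y.setBit b o' := fun e =>
      h (by simpa using congrArg (fun z => z.setBit b false) e)
    have : x ≠ y := fun hxy => h (by rw [hxy])
    simp only [hiff, this, if_false, mul_zero, Finset.sum_const_zero]

/-! ### Inverse circuits -/

/-- The controlled phase rotations, the only gates for which `Gate.adj` gives no inverse. -/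
def Gate.isPhase : Gate n → Bool
  | cPhase .. => true
  | _ => false

/-- The inverse of a gate other than `cPhase`. -/
def Gate.adj : Gate n → Circuit n
  | pos inv r s h => [pos (!inv) r s h]
  | val inv r s t h => [val (!inv) r s t h]
  | single b U => [single b U⁻¹]
  | cnot c b h => [cnot c b h]
  | toffoli c c' b h h' => [toffoli c c' b h h']
  | idxConst w t => [idxConst (-w) t]
  | idxAdd inv s t h => [idxAdd (!inv) s t h]
  | cIdxAdd inv c s t h => [cIdxAdd (!inv) c s t h]
  | idxSwap s t => [idxSwap s t]
  | idxEq r s b => [idxEq r s b]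
  | idxLt r s b => [idxLt r s b]
  | numConst q t => [numConst (-q) t]
  | numBit inv b t => [numBit (!inv) b t]
  | numUn inv f s t h => [numUn (!inv) f s t h]
  | numBin inv f s s' t h h' => [numBin (!inv) f s s' t h h']
  | cRot c s b h => [single b pauliZ, cRot c s b h, single b pauliZ]
  | cPhase .. => []

/-- The inverse of a circuit without `cPhase`. -/
def Circuit.adj (c : Circuit n) : Circuit n := c.reverse.flatMap Gate.adj

lemma adj_cons (g : Gate n) (c : Circuit n) :
    Circuit.adj (g :: c) = Circuit.adj c ++ g.adj := by
  simp [Circuit.adj]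

/-- The factor 3 is the price of inverting a controlled rotation. -/
lemma length_adj_le (c : Circuit n) : (Circuit.adj c).length ≤ 3 * c.length := by
  induction c with
  | nil => simp [Circuit.adj]
  | cons g c ih =>
    rw [adj_cons, List.length_append, List.length_cons]
    have : g.adj.length ≤ 3 := by cases g <;> simp [Gate.adj]
    omega

lemma addOrSub_not {R : Type} [AddGroup R] (inv : Bool) (x y : R) :
    addOrSub (!inv) (addOrSub inv x y) y = x := by
  cases inv <;> simp [addOrSub]

lemma fwdOrInv_not {R : Type} (inv : Bool) (e : Equiv.Perm R) (x : R) :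
    fwdOrInv (!inv) e (fwdOrInv inv e x) = x := by
  cases inv <;> simp [fwdOrInv]

lemma xor_xor_self (a b : Bool) : ((a ^^ b) ^^ b) = a := by cases a <;> cases b <;> rfl

/-- The cases in which a gate permutes the basis states. -/
lemma exists_inverse_or_qubit (O : Oracle n) (g : Gate n) (hg : g.isPhase = false) :
    (∃ (g' : Gate n) (f f' : Mem n → Mem n), g.adj = [g'] ∧ (∀ x, g.onBasis O x = ket (f x)) ∧
      (∀ x, g'.onBasis O x = ket (f' x)) ∧ ∀ x, f' (f x) = x) ∨
    (∃ b U, g = .single b U) ∨ ∃ c s b h, g = .cRot c s b h := by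
  cases g with
  | cPhase => simp [Gate.isPhase] at hg
  | single b U => exact .inr (.inl ⟨b, U, rfl⟩)
  | cRot c s b h => exact .inr (.inr ⟨c, s, b, h, rfl⟩)
  | pos inv r s h =>
    refine .inl ⟨_, _, _, rfl, fun x => rfl, fun x => rfl, fun x => ?_⟩
    simp only [idx_setIdx, if_neg h, if_true, Prod.mk.eta, fwdOrInv_not]
    ext k
    · simp only [idx_setIdx]; split_ifs with h1 h2 <;> simp_all
    all_goals rfl
  | val inv r s t h =>
    refine .inl ⟨_, _, _, rfl, fun x => rfl, fun x => rfl, fun x => ?_⟩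
    simp only [idx_setIdx, idx_setNum, num_setNum, if_neg h, if_true, Prod.mk.eta, fwdOrInv_not]
    ext k
    · simp only [idx_setIdx, idx_setNum]; split_ifs with h1 h2 <;> simp_all
    · rfl
    · simp only [num_setNum, num_setIdx]; split_ifs with h1 <;> simp_all
  | idxSwap s t =>
    refine .inl ⟨_, _, _, rfl, fun x => rfl, fun x => rfl, fun x => ?_⟩
    ext k
    · simp only [idx_setIdx]; split_ifs <;> simp_all
    all_goals rfl
  | cIdxAdd inv c s t h =>
    refine .inl ⟨_, _, _, rfl, fun x => rfl, fun x => rfl, fun x => ?_⟩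
    by_cases hc : x.bit c
    · simp [hc, h, addOrSub_not, setIdx_eq_self]
    · simp [hc]
  | idxAdd inv s t h =>
    refine .inl ⟨_, _, _, rfl, fun x => rfl, fun x => rfl, fun x => ?_⟩
    simp [h, addOrSub_not, setIdx_eq_self]
  | cnot c b h =>
    refine .inl ⟨_, _, _, rfl, fun x => rfl, fun x => rfl, fun x => ?_⟩
    simp [h, setBit_eq_self]
  | toffoli c c' b h h' =>
    refine .inl ⟨_, _, _, rfl, fun x => rfl, fun x => rfl, fun x => ?_⟩
    simp [h, h', setBit_eq_self]
  | idxConst w t =>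
    refine .inl ⟨_, _, _, rfl, fun x => rfl, fun x => rfl, fun x => ?_⟩
    simp [setIdx_eq_self]
  | idxEq r s b =>
    refine .inl ⟨_, _, _, rfl, fun x => rfl, fun x => rfl, fun x => ?_⟩
    simp only [idx_setBit, bit_setBit, if_true, setBit_setBit]
    exact setBit_eq_self (xor_xor_self _ _).symm
  | idxLt r s b =>
    refine .inl ⟨_, _, _, rfl, fun x => rfl, fun x => rfl, fun x => ?_⟩
    simp only [idx_setBit, bit_setBit, if_true, setBit_setBit]
    exact setBit_eq_self (xor_xor_self _ _).symm
  | numConst q t =>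
    refine .inl ⟨_, _, _, rfl, fun x => rfl, fun x => rfl, fun x => ?_⟩
    simp [setNum_eq_self]
  | numBit inv b t =>
    refine .inl ⟨_, _, _, rfl, fun x => rfl, fun x => rfl, fun x => ?_⟩
    simp only [bit_setNum, num_setNum, if_true, setNum_setNum]
    exact setNum_eq_self (addOrSub_not _ _ _).symm
  | numUn inv f s t h =>
    refine .inl ⟨_, _, _, rfl, fun x => rfl, fun x => rfl, fun x => ?_⟩
    simp [h, addOrSub_not, setNum_eq_self]
  | numBin inv f s s' t h h' =>
    refine .inl ⟨_, _, _, rfl, fun x => rfl, fun x => rfl, fun x => ?_⟩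
    simp [h, h', addOrSub_not, setNum_eq_self]

lemma run_gate_adj (O : Oracle n) (g : Gate n) (hg : g.isPhase = false) (v : State n) :
    Circuit.run O g.adj (Circuit.run O [g] v) = v := by
  suffices (Circuit.run O g.adj).comp (Circuit.run O [g]) = LinearMap.id from
    LinearMap.congr_fun this v
  refine linearMap_ext_ket fun x => ?_
  rw [LinearMap.comp_apply, LinearMap.id_apply, run_cons_ket, run_nil]
  rcases exists_inverse_or_qubit O g hg with ⟨g', f, f', ha, hf, hf', hff⟩ | ⟨b, U, rfl⟩ | ⟨c, s, b, h, rfl⟩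
  · rw [ha, hf, run_cons_ket, run_nil, hf', hff]
  · change Circuit.run O [.single b U⁻¹] (applyQubit U.1 b x) = _
    rw [run_applyQubit O (M' := (U⁻¹).1) fun o => rfl, ← Submonoid.coe_mul, inv_mul_cancel]
    exact applyQubit_one b x
  · change Circuit.run O [.single b pauliZ, .cRot c s b h, .single b pauliZ] _ = _
    by_cases hc : x.bit c
    · have h1 : (Gate.cRot c s b h).onBasis O x = applyQubit (rotation (x.num s).re) b x := by
        simp [Gate.onBasis, hc]
      rw [h1, run_cons, run_cons _ (.cRot c s b h), run_applyQubit O (M' := pauliZ.1) fun o => rfl,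
        run_applyQubit O (M' := rotation (x.num s).re) (fun o => by simp [Gate.onBasis, hc, h]),
        run_applyQubit O (M' := pauliZ.1) fun o => rfl, ← Matrix.mul_assoc, ← Matrix.mul_assoc,
        pauliZ_conj_rotation, conjTranspose_rotation_mul_self, applyQubit_one]
    -- The two $Z$ gates are not controlled; with the control off they cancel.
    · have h1 : (Gate.cRot c s b h).onBasis O x = applyQubit 1 b x := by
        simp [Gate.onBasis, hc, applyQubit_one]
      rw [h1, run_cons, run_cons _ (.cRot c s b h), run_applyQubit O (M' := pauliZ.1) fun o => rfl,
        run_applyQubit O (M' := 1) (fun o => by simp [Gate.onBasis, hc, h, applyQubit_one]),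
        run_applyQubit O (M' := pauliZ.1) fun o => rfl, Matrix.mul_one, Matrix.one_mul,
        pauliZ_mul_self, applyQubit_one]

lemma run_adj_run (O : Oracle n) {c : Circuit n} (hc : ∀ g ∈ c, g.isPhase = false) (v : State n) :
    Circuit.run O (Circuit.adj c) (Circuit.run O c v) = v := by
  induction c generalizing v with
  | nil => rfl
  | cons g c ih =>
    rw [adj_cons, run_append, run_cons, ih (fun g hg => hc g (List.mem_cons_of_mem _ hg)),
      run_gate_adj O g (hc g List.mem_cons_self)]

open Classical in
lemma isometry_gate (O : Oracle n) (g : Gate n) (hg : g.isPhase = false) (v w : State n) :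
    braket (Circuit.run O [g] v) (Circuit.run O [g] w) = braket v w := by
  refine isometry_of_ket _ (fun x y => ?_) v w
  simp only [run_cons_ket, run_nil]
  rcases exists_inverse_or_qubit O g hg with ⟨g', f, f', ha, hf, hf', hff⟩ | ⟨b, U, rfl⟩ | ⟨c, s, b, h, rfl⟩
  · have : f x = f y ↔ x = y := ⟨fun h => by rw [← hff x, h, hff], fun h => by rw [h]⟩
    rw [hf, hf, braket_ket_ket, braket_ket_ket]
    simp only [this]
  · exact braket_applyQubit (Matrix.mem_unitaryGroup_iff'.1 U.2) b x y
  · -- distinct controls or angles make the images orthogonal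
    have hz (M M' : Matrix Bool Bool ℂ) (hne : x.setBit b false ≠ y.setBit b false) :
        braket (applyQubit M b x) (applyQubit M' b y) = braket (ket x) (ket y) := by
      have hxy : x ≠ y := fun e => hne (by rw [e])
      have hne' (o o' : Bool) : x.setBit b o ≠ y.setBit b o' := fun e =>
        hne (by simpa using congrArg (fun z => z.setBit b false) e)
      simp only [applyQubit, braket_sum_left, braket_sum_right, braket_smul_left,
        braket_smul_right, braket_ket_ket, hne', hxy, if_false, mul_zero, Finset.sum_const_zero]
    have h1 (x : Mem n) : (Gate.cRot c s b h).onBasis O x =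
        applyQubit (if x.bit c then rotation (x.num s).re else 1) b x := by
      by_cases hc : x.bit c <;> simp [Gate.onBasis, hc, applyQubit_one]
    rw [h1, h1]
    by_cases hxy : x.setBit b false = y.setBit b false
    · have hb : x.bit c = y.bit c := by
        simpa [h] using congrArg (fun z => z.bit c) hxy
      have hn : x.num s = y.num s := by
        simpa using congrArg (fun z => z.num s) hxy
      rw [hb, hn]
      refine braket_applyQubit ?_ b x y
      split_ifs
      · exact conjTranspose_rotation_mul_self _
      · simp
    · exact hz _ _ hxy

lemma isometry_run (O : Oracle n) {c : Circuit n} (hc : ∀ g ∈ c, g.isPhase = false)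
    (v w : State n) : braket (Circuit.run O c v) (Circuit.run O c w) = braket v w := by
  induction c generalizing v w with
  | nil => rfl
  | cons g c ih =>
    rw [run_cons, run_cons O g c w, ih (fun g hg => hc g (List.mem_cons_of_mem _ hg)),
      isometry_gate O g (hc g List.mem_cons_self)]

lemma isPhase_adj {c : Circuit n} (hc : ∀ g ∈ c, g.isPhase = false) :
    ∀ g ∈ Circuit.adj c, g.isPhase = false := by
  intro g hg
  obtain ⟨g', hg', h⟩ := List.mem_flatMap.1 hg
  have := hc g' (List.mem_reverse.1 hg')
  cases g' <;> simp only [Gate.adj, List.mem_cons, List.not_mem_nil, or_false] at h <;>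
    first | (subst h; rfl) | (rcases h with rfl | rfl | rfl <;> rfl)

/-! ### Circuits that implement unitaries -/

lemma load_injective : Function.Injective (load (n := n)) := by
  rintro ⟨⟨a, w, b⟩, i⟩ ⟨⟨a', w', b'⟩, i'⟩ h
  have h0 := congrFun (congrArg Mem.idx h) 0
  have h1 := congrFun (congrArg Mem.idx h) 1
  have h2 := congrFun (congrArg Mem.bit h) 0
  have h3 := congrFun (congrArg Mem.bit h) 1
  simp [load, reg₁, reg₂] at h0 h1 h2 h3
  simp [h0, h1, h2, h3]

open Classical in
lemma ket_load_apply (x y : Anc n × Word n) :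
    ket (load x) (load y) = if x = y then 1 else 0 := by
  rw [ket, Finsupp.single_apply]
  simp [load_injective.eq_iff]

lemma Implements.apply {O : Oracle n} {c : Circuit n}
    {U : Matrix (Anc n × Word n) (Anc n × Word n) ℂ} (h : Implements O c U) (x y : Anc n × Word n) :
    U y x = c.run O (ket (load x)) (load y) := by
  classical
  rw [h x, Finsupp.finsetSum_apply]
  simp [ket_load_apply]

lemma Implements.append {O : Oracle n} {c c' : Circuit n}
    {U U' : Matrix (Anc n × Word n) (Anc n × Word n) ℂ} (h : Implements O c U)
    (h' : Implements O c' U') : Implements O (c ++ c') (U' * U) := by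
  intro x
  rw [run_append, h x, map_sum]
  simp_rw [map_smul, h' _, Matrix.mul_apply, Finset.smul_sum, Finset.sum_smul, smul_smul]
  rw [Finset.sum_comm]
  simp_rw [mul_comm]

/-- Superpositions of memories in which only the two registers are non-zero. -/
def loads (n : ℕ) : Submodule ℂ (State n) := Submodule.span ℂ (Set.range fun x => ket (load x))

/-- An isometry that maps a finite-dimensional space into itself is unitary. Invariance of `loads n`
is thus all that has to be checked for a concrete circuit. -/
theorem exists_unitary_implements (O : Oracle n) {c : Circuit n}
    (hc : ∀ g ∈ c, g.isPhase = false) (h : ∀ x, c.run O (ket (load x)) ∈ loads n) :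
    ∃ U ∈ Matrix.unitaryGroup (Anc n × Word n) ℂ,
      Implements O c U ∧ Implements O (Circuit.adj c) Uᴴ := by
  classical
  have hex : ∀ x, ∃ u : Anc n × Word n → ℂ,
      ∑ y, u y • ket (load y) = c.run O (ket (load x)) := fun x =>
    (Submodule.mem_span_range_iff_exists_fun ℂ).1 (h x)
  choose u hu using hex
  let U : Matrix (Anc n × Word n) (Anc n × Word n) ℂ := Matrix.of fun y x => u x y
  have hU : Implements O c U := fun x => (hu x).symm
  have hUU : Uᴴ * U = 1 := by
    ext x y
    have h1 := isometry_run O hc (ket (load x)) (ket (load y))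
    rw [hU x, hU y, braket_ket_left, ket_load_apply] at h1
    simp only [braket_sum_left, braket_sum_right, braket_smul_left, braket_smul_right,
      braket_ket_left, ket_load_apply] at h1
    rw [Matrix.mul_apply, Matrix.one_apply]
    simp only [mul_ite, mul_one, mul_zero, Finset.mem_univ, if_true,
      Finset.sum_ite_eq] at h1
    rw [if_congr (eq_comm (a := x)) rfl rfl, ← h1]
    simp [Matrix.conjTranspose_apply, mul_comm]
  have hUU' : U * Uᴴ = 1 := mul_eq_one_comm.1 hUU
  refine ⟨U, Matrix.mem_unitaryGroup_iff'.2 hUU, hU, fun x => ?_⟩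
  -- By `hUU'`, the circuit sends the column $U^\dagger|x\rangle$ to $|x\rangle$, so the inverse
  -- circuit sends $|x\rangle$ back to that column.
  have h2 : ket (load x) = c.run O (∑ z, Uᴴ z x • ket (load z)) := by
    rw [map_sum]
    simp_rw [map_smul, hU _, Finset.smul_sum, smul_smul]
    rw [Finset.sum_comm]
    simp_rw [← Finset.sum_smul, mul_comm (Uᴴ _ _), ← Matrix.mul_apply, hUU', Matrix.one_apply]
    simp
  rw [h2, run_adj_run O hc]

/-! ### Two-level rotations -/

/-- The Pauli matrix `X`. -/
def pauliX : Matrix.unitaryGroup Bool ℂ :=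
  ⟨Matrix.of fun i j => if i = j then 0 else 1, by
    rw [Matrix.mem_unitaryGroup_iff]
    ext i j
    cases i <;> cases j <;> simp [Matrix.mul_apply, Matrix.star_apply]⟩

/-- A unitary that diagonalises all rotations. -/
def rotBasis : Matrix.unitaryGroup Bool ℂ :=
  ⟨Matrix.of fun i j => ((√2)⁻¹ : ℝ) * (if i then (if j then -Complex.I else Complex.I) else 1), by
    have h : (((√2)⁻¹ : ℝ) : ℂ) * (((√2)⁻¹ : ℝ) : ℂ) = 1 / 2 := by
      rw [← Complex.ofReal_mul, ← mul_inv, Real.mul_self_sqrt (by norm_num)]; norm_num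
    rw [Matrix.mem_unitaryGroup_iff]
    ext i j
    cases i <;> cases j <;>
      simp [Matrix.mul_apply, Matrix.star_apply, - Complex.ofReal_inv] <;>
      first
        | ring1
        | linear_combination 2 * h
        | linear_combination (-2 * ((((√2)⁻¹ : ℝ) : ℂ) * (((√2)⁻¹ : ℝ) : ℂ))) * Complex.I_sq + 2 * h⟩

/-- `diag(e^{-iβ}, e^{iβ})` -/
def twist (β : ℝ) : Matrix Bool Bool ℂ :=
  Matrix.diagonal fun b => Complex.exp ((if b then β else -β : ℝ) * Complex.I)

lemma twist_apply (β : ℝ) (i j : Bool) : twist β i j =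
    if i = j then Complex.exp ((if i then β else -β : ℝ) * Complex.I) else 0 :=
  Matrix.diagonal_apply ..

/-- The columns of `rotBasis` are eigenvectors of every rotation, with eigenvalues $e^{\mp i\beta}$.
Controlled phases are therefore obtained from controlled rotations. -/
lemma rotation_mul_rotBasis (β : ℝ) : rotation β * rotBasis.1 = rotBasis.1 * twist β := by
  ext i j
  cases i <;> cases j <;>
    simp [Matrix.mul_apply, rotBasis, rotation, twist_apply, Complex.exp_mul_I,
      - Complex.ofReal_inv, - neg_mul] <;>
    first
      | ring1
      | linear_combination (-((((√2)⁻¹ : ℝ) : ℂ)) * Complex.sin β) * Complex.I_sq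
      | linear_combination (((((√2)⁻¹ : ℝ) : ℂ)) * Complex.sin β) * Complex.I_sq

lemma rotBasis_conj_rotation (β : ℝ) :
    (rotBasis⁻¹).1 * (rotation β * rotBasis.1) = twist β := by
  rw [rotation_mul_rotBasis, ← Matrix.mul_assoc, ← Submonoid.coe_mul, inv_mul_cancel]
  exact Matrix.one_mul _

/-- The matrix `diag(e^{-iβ}, e^{iβ}) · rotation θ · diag(e^{iβ}, e^{-iβ})`. -/
def twistedRotation (β θ : ℝ) : Matrix Bool Bool ℂ :=
  twist β * (rotation θ * (pauliX.1 * (twist β * pauliX.1)))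

lemma twistedRotation_false_false (β θ : ℝ) :
    twistedRotation β θ false false = Complex.cos θ := by
  simp only [twistedRotation, pauliX, Matrix.mul_apply, Matrix.of_apply, Fintype.sum_bool,
    twist_apply]
  simp only [rotation, if_true, Bool.false_eq_true, if_false, reduceCtorEq, mul_zero, zero_mul,
    zero_add, add_zero, mul_one, one_mul, Complex.ofReal_cos]
  rw [mul_left_comm, ← Complex.exp_add]
  simp

/-- The two twists cancel on the diagonal and add up to $2\beta$ here. The doubling suits an angle
$\beta$ that is the argument of a square root. -/
lemma twistedRotation_true_false (β θ : ℝ) :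
    twistedRotation β θ true false = Complex.exp (β * Complex.I) ^ 2 * Complex.sin θ := by
  simp only [twistedRotation, pauliX, Matrix.mul_apply, Matrix.of_apply, Fintype.sum_bool,
    twist_apply]
  simp only [rotation, if_true, Bool.false_eq_true, if_false, reduceCtorEq, mul_zero, zero_mul,
    zero_add, add_zero, mul_one, one_mul, Complex.ofReal_sin]
  ring

/-- On the qubit `1`, controlled on the qubit `2`: the twisted rotation whose angles are stored in
the number registers `6` and `11`. -/
def twistedRotationCircuit : Circuit n :=
  [.single 1 pauliX, .single 1 rotBasis, .cRot 2 6 1 (by decide), .single 1 rotBasis⁻¹,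
    .single 1 pauliX, .cRot 2 11 1 (by decide), .single 1 rotBasis, .cRot 2 6 1 (by decide),
    .single 1 rotBasis⁻¹]

lemma run_twistedRotationCircuit (O : Oracle n) (x : Mem n) :
    Circuit.run O twistedRotationCircuit (ket x) =
      if x.bit 2 then applyQubit (twistedRotation (x.num 6).re (x.num 11).re) 1 x else ket x := by
  have hrot (s : ℕ) (M : Matrix Bool Bool ℂ) :
      Circuit.run O [.cRot 2 s 1 (by decide)] (applyQubit M 1 x) =
        applyQubit ((if x.bit 2 then rotation (x.num s).re else 1) * M) 1 x :=
    run_applyQubit O (fun o => by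
      by_cases h : x.bit 2 <;> simp [Gate.onBasis, h, applyQubit_one]) M
  have hsingle (U : Matrix.unitaryGroup Bool ℂ) (M : Matrix Bool Bool ℂ) :
      Circuit.run O [.single 1 U] (applyQubit M 1 x) = applyQubit (U.1 * M) 1 x :=
    run_applyQubit O (fun o => rfl) M
  rw [← applyQubit_one 1 x, twistedRotationCircuit]
  iterate 8 rw [run_cons]
  simp only [hrot, hsingle]
  have hX : pauliX.1 * pauliX.1 = 1 := by
    ext i j
    cases i <;> cases j <;> simp [pauliX, Matrix.mul_apply]
  split_ifs
  · congr 1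
    rw [twistedRotation, ← rotBasis_conj_rotation]
    simp only [Matrix.mul_assoc, Matrix.mul_one]
  -- With the control off, only the basis changes and the two $X$ gates remain, and they cancel in
  -- pairs.
  · have h (M : Matrix Bool Bool ℂ) : (rotBasis⁻¹).1 * (rotBasis.1 * M) = M := by
      rw [← Matrix.mul_assoc, ← Submonoid.coe_mul, inv_mul_cancel]
      exact Matrix.one_mul _
    simp only [Matrix.one_mul, h]
    rw [Matrix.mul_one, hX]

/-! ### The contents of the memory during the computation -/

/-- Index registers `0, …, 3` hold `i, w, c, p`, the qubits `0, 1, 3` hold `b₀, b₁, e`, and the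
number registers hold `z`. -/
def conf (i w c p : Word n) (b₀ b₁ e : Bool) (z : ℕ → ℂ) : Mem n where
  idx
    | 0 => i
    | 1 => w
    | 2 => c
    | 3 => p
    | _ => 0
  bit
    | 0 => b₀
    | 1 => b₁
    | 3 => e
    | _ => false
  num := z

/-- Only the residual weight `S` is stored. -/
def residualNums (S : ℂ) : ℕ → ℂ
  | 7 => S
  | _ => 0

/-- The residual weight, the matrix entry `α`, and the weight and the phase of its amplitude. -/
def entryNums (f g : UnOp) (δ α S : ℂ) : ℕ → ℂ
  | 0 => α
  | 1 => δ - α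
  | 2 => (‖δ - α‖ : ℝ)
  | 3 => f.eval (δ - α)
  | 4 => g.eval (f.eval (δ - α))
  | 5 => Complex.sqrt (g.eval (f.eval (δ - α)))
  | 6 => (Complex.arg (Complex.sqrt (g.eval (f.eval (δ - α)))) : ℝ)
  | 7 => S
  | _ => 0

/-- Additionally, the rotation angle. -/
def angleNums (z : ℕ → ℂ) : ℕ → ℂ
  | 8 => z 7 - z 2
  | 9 => (z 7 - z 2) / z 7
  | 10 => Complex.sqrt ((z 7 - z 2) / z 7)
  | 11 => (Real.arccos (Complex.sqrt ((z 7 - z 2) / z 7)).re : ℝ)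
  | k => z k

/-- Look up the `ν`-th entry of the row `c`. -/
def entryCircuit (f g : UnOp) (ν : ℕ) : Circuit n :=
  [.idxConst (word n ν) 3, .pos false 2 3 (by decide), .val false 2 3 0 (by decide), .idxEq 2 3 3,
    .numBit false 3 1, .numUn true .copy 0 1 (by decide), .numUn false .abs 1 2 (by decide),
    .numUn false f 1 3 (by decide), .numUn false g 3 4 (by decide),
    .numUn false .sqrt 4 5 (by decide), .numUn false .arg 5 6 (by decide)]

/-- Compute the rotation angle. -/
def angleCircuit : Circuit n :=
  [.numUn false .copy 7 8 (by decide), .numUn true .copy 2 8 (by decide),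
    .numBin false .div 8 7 9 (by decide) (by decide), .numUn false .sqrt 9 10 (by decide),
    .numUn false .arccos 10 11 (by decide)]

/-- A rotation in the plane spanned by `|0⟩|0⟩` and `|p⟩|1⟩`. -/
def moveCircuit : Circuit n :=
  [.cIdxAdd true 1 3 1 (by decide), .idxEq 1 4 2] ++ twistedRotationCircuit ++
    [.idxEq 1 4 2, .cIdxAdd false 1 3 1 (by decide)]

lemma run_entryCircuit (O : Oracle n) (f g : UnOp) {ν : ℕ} {c p : Word n} {α : ℂ}
    (hpos : O.pos (c, word n ν) = (c, p)) (hval : ∀ z, O.val (c, p, z) = (c, p, z + α))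
    (i w : Word n) (b₀ b₁ : Bool) (S : ℂ) :
    Circuit.run O (entryCircuit f g ν) (ket (conf i w c 0 b₀ b₁ false (residualNums S))) =
      ket (conf i w c p b₀ b₁ (decide (c = p))
        (entryNums f g (if c = p then 1 else 0) α S)) := by
  simp only [entryCircuit, run_cons_ket, Gate.onBasis, run_nil]
  congr 1
  ext k
  · rcases k with _ | _ | _ | _ | k <;> simp [conf, fwdOrInv, hpos, hval]
  · rcases k with _ | _ | _ | _ | k <;> simp [conf, fwdOrInv, hpos, hval]
  · rcases k with _ | _ | _ | _ | _ | _ | _ | _ | k <;>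
      simp [conf, fwdOrInv, hpos, hval, residualNums, entryNums, addOrSub, UnOp.eval]

lemma run_angleCircuit (O : Oracle n) (i w c p : Word n) (b₀ b₁ e : Bool) (z : ℕ → ℂ)
    (h8 : z 8 = 0) (h9 : z 9 = 0) (h10 : z 10 = 0) (h11 : z 11 = 0) :
    Circuit.run O angleCircuit (ket (conf i w c p b₀ b₁ e z)) =
      ket (conf i w c p b₀ b₁ e (angleNums z)) := by
  simp only [angleCircuit, run_cons_ket, Gate.onBasis, run_nil]
  congr 1
  ext k
  · rfl
  · rfl
  · rcases k with _ | _ | _ | _ | _ | _ | _ | _ | _ | _ | _ | _ | k <;>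
      simp [conf, angleNums, addOrSub, UnOp.eval, BinOp.eval, h8, h9, h10, h11]

/-- Subtracting `p` when the flag is set turns the plane of $|0\rangle|0\rangle$ and
$|p\rangle|1\rangle$ into the flag qubit over the zero word. A comparison with index register 4,
which is zero, then controls a one-qubit rotation. -/
lemma run_moveCircuit (O : Oracle n) (i w c p : Word n) (b₀ b₁ e : Bool) (z : ℕ → ℂ) :
    Circuit.run O moveCircuit (ket (conf i w c p b₀ b₁ e z)) =
      if (if b₁ then w - p else w) = 0 then
        ∑ o, twistedRotation (z 6).re (z 11).re o b₁ •
          ket (conf i (if o then p else 0) c p b₀ o e z)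
      else ket (conf i w c p b₀ b₁ e z) := by
  set w' := if b₁ then w - p else w with hw'
  have h1 : Circuit.run O [.cIdxAdd true 1 3 1 (by decide), .idxEq 1 4 2]
      (ket (conf i w c p b₀ b₁ e z)) =
      ket ((conf i w' c p b₀ b₁ e z).setBit 2 (decide (w' = 0))) := by
    simp only [run_cons_ket, Gate.onBasis, run_nil]
    congr 1
    ext k
    · rcases k with _ | _ | _ | _ | k <;> cases b₁ <;> simp [conf, hw', addOrSub]
    · rcases k with _ | _ | _ | _ | k <;> cases b₁ <;> simp [conf, hw', addOrSub]
    · cases b₁ <;> simp [conf]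
  -- The comparison is repeated before `p` is added back, so it still sees `u` and clears qubit 2
  -- whatever the flag has become.
  have h2 (u : Word n) (o : Bool) : Circuit.run O
      [.idxEq 1 4 2, .cIdxAdd false 1 3 1 (by decide)]
      (ket ((conf i u c p b₀ o e z).setBit 2 (decide (u = 0)))) =
      ket (conf i (if o then u + p else u) c p b₀ o e z) := by
    simp only [run_cons_ket, Gate.onBasis, run_nil]
    congr 1
    ext k
    · rcases k with _ | _ | _ | _ | k <;> cases o <;> simp [conf, addOrSub]
    · rcases k with _ | _ | _ | _ | k <;> cases o <;> simp [conf, addOrSub]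
    · cases o <;> simp [conf]
  rw [moveCircuit, run_append, run_append, h1, run_twistedRotationCircuit]
  simp only [bit_setBit, if_true, decide_eq_true_eq]
  by_cases hw : w' = 0
  · rw [if_pos hw, if_pos hw, applyQubit, map_sum]
    refine Finset.sum_congr rfl fun o _ => ?_
    rw [map_smul]
    have h3 : ((conf i w' c p b₀ b₁ e z).setBit 2 (decide (w' = 0))).setBit 1 o =
        (conf i w' c p b₀ o e z).setBit 2 (decide (w' = 0)) := by
      ext k
      · rfl
      · rcases k with _ | _ | _ | _ | k <;> simp [conf]
      · rfl
    rw [h3, h2, hw]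
    simp [conf]
  · rw [if_neg hw, if_neg hw, h2]
    congr 2
    rw [hw']
    cases b₁ <;> simp

/-! ### Square roots and angles -/

lemma sqrt_sq (z : ℂ) : Complex.sqrt z ^ 2 = z := by
  simp [Complex.sqrt]

lemma norm_sqrt_sq (z : ℂ) : ‖Complex.sqrt z‖ ^ 2 = ‖z‖ := by
  rw [← norm_pow, sqrt_sq]

/-- This is the square of the polar form of $\sqrt a$. The factor $|a|$ makes it valid at $a=0$ too,
where the argument is a default value. -/
lemma exp_arg_sqrt_sq (a : ℂ) :
    Complex.exp ((Complex.arg (Complex.sqrt a) : ℝ) * Complex.I) ^ 2 * (‖a‖ : ℝ) = a := by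
  conv_rhs => rw [← sqrt_sq a, ← Complex.norm_mul_exp_arg_mul_I (Complex.sqrt a)]
  rw [← norm_sqrt_sq a]
  push_cast
  ring

lemma sqrt_ofReal {x : ℝ} (hx : 0 ≤ x) : Complex.sqrt x = (√x : ℝ) := by
  rw [Complex.sqrt_of_nonneg (by exact_mod_cast hx)]
  simp

/-- The angle of the rotation that splits the weight `t` off the weight `S`. -/
def splitAngle (S t : ℝ) : ℝ := Real.arccos (Complex.sqrt (((S : ℂ) - t) / S)).re

lemma splitAngle_eq {S t : ℝ} (ht : 0 ≤ t) (hS : t ≤ S) :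
    splitAngle S t = Real.arccos √((S - t) / S) := by
  have : ((S : ℂ) - t) / S = (((S - t) / S : ℝ) : ℂ) := by push_cast; rfl
  rw [splitAngle, this, sqrt_ofReal (div_nonneg (by linarith) (by linarith)), Complex.ofReal_re]

lemma sqrt_mul_cos_splitAngle {S t : ℝ} (ht : 0 ≤ t) (hS : t ≤ S) :
    √S * Real.cos (splitAngle S t) = √(S - t) := by
  have hS0 : 0 ≤ S := ht.trans hS
  have h1 : (S - t) / S ≤ 1 := div_le_one_of_le₀ (by linarith) hS0
  rw [splitAngle_eq ht hS, Real.cos_arccos (by linarith [Real.sqrt_nonneg ((S - t) / S)])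
    (Real.sqrt_le_one.2 h1), ← Real.sqrt_mul hS0]
  -- If $S=0$, then $t=0$ and the quotient has the default value $0$; the resulting angle is
  -- immaterial because of the factor $\sqrt S$.
  rcases hS0.eq_or_lt with h0 | h0
  · have : t = 0 := by linarith
    simp [← h0, this]
  · rw [mul_div_cancel₀ _ h0.ne']

lemma sqrt_mul_sin_splitAngle {S t : ℝ} (ht : 0 ≤ t) (hS : t ≤ S) :
    √S * Real.sin (splitAngle S t) = √t := by
  have hS0 : 0 ≤ S := ht.trans hS
  have h1 : 0 ≤ (S - t) / S := div_nonneg (by linarith) hS0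
  rw [splitAngle_eq ht hS, Real.sin_arccos, Real.sq_sqrt h1, ← Real.sqrt_mul hS0]
  rcases hS0.eq_or_lt with h0 | h0
  · have : t = 0 := by linarith
    simp [← h0, this]
  · congr 1
    field_simp
    ring

/-! ### One step of the state preparation -/

/-- Rotate the `ν`-th entry into the superposition and update the residual weight. -/
def stepCircuit (f g : UnOp) (ν : ℕ) : Circuit n :=
  entryCircuit f g ν ++ angleCircuit ++ moveCircuit ++ (Circuit.adj angleCircuit ++
    [.numUn true .copy 2 7 (by decide)] ++ Circuit.adj (entryCircuit f g ν))

/-- Undo the `ν`-th update of the residual weight. -/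
def restoreCircuit (f g : UnOp) (ν : ℕ) : Circuit n :=
  entryCircuit f g ν ++ [.numUn false .copy 2 7 (by decide)] ++ Circuit.adj (entryCircuit f g ν)

/-- Only the registers and the residual weight are non-zero. -/
abbrev idle (i c : Word n) (b₀ : Bool) (S : ℝ) (y : Word n × Bool) : Mem n :=
  conf i y.1 c 0 b₀ y.2 false (residualNums S)

/-- The weight of a matrix entry in the state to be prepared. -/
def weight (c p : Word n) (α : ℂ) : ℝ := ‖(if c = p then 1 else 0) - α‖

/-- The amplitude of a matrix entry in the state to be prepared. -/
def amplitude (f g : UnOp) (c p : Word n) (α : ℂ) : ℂ :=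
  g.eval (f.eval ((if c = p then 1 else 0) - α))

lemma isPhase_entryCircuit (f g : UnOp) (ν : ℕ) :
    ∀ x ∈ (entryCircuit f g ν : Circuit n), x.isPhase = false := by
  simp [entryCircuit, Gate.isPhase]

lemma isPhase_angleCircuit : ∀ x ∈ (angleCircuit : Circuit n), x.isPhase = false := by
  simp [angleCircuit, Gate.isPhase]

lemma run_numUn_copy (O : Oracle n) (inv : Bool) (f g : UnOp) (δ α S : ℂ) (i w c p : Word n)
    (b₀ b₁ e : Bool) :
    Circuit.run O [.numUn inv .copy 2 7 (by decide)]
      (ket (conf i w c p b₀ b₁ e (entryNums f g δ α S))) =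
      ket (conf i w c p b₀ b₁ e (entryNums f g δ α (addOrSub inv S (‖δ - α‖ : ℝ)))) := by
  simp only [run_cons_ket, Gate.onBasis, run_nil]
  congr 1
  ext k
  · rfl
  · rfl
  · rcases k with _ | _ | _ | _ | _ | _ | _ | _ | k <;> simp [conf, entryNums, UnOp.eval]

/-- The scratch data depend on the row, `ν` and `S` but not on the second register, so they can be
uncomputed after the rotation. The angle has to be cleared with the old `S`; only then is the weight
subtracted, and the entry, which does not involve `S`, is cleared last. -/
lemma run_stepCircuit (O : Oracle n) (f g : UnOp) {ν : ℕ} {c p : Word n} {α : ℂ}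
    (hpos : O.pos (c, word n ν) = (c, p)) (hval : ∀ z, O.val (c, p, z) = (c, p, z + α))
    (i : Word n) (b₀ : Bool) (S : ℝ) (y : Word n × Bool) :
    Circuit.run O (stepCircuit f g ν) (ket (idle i c b₀ S y)) =
      if (if y.2 then y.1 - p else y.1) = 0 then
        ∑ o, twistedRotation (Complex.arg (Complex.sqrt (amplitude f g c p α)))
          (splitAngle S (weight c p α)) o y.2 •
          ket (idle i c b₀ (S - weight c p α) (if o then p else 0, o))
      else ket (idle i c b₀ (S - weight c p α) y) := by
  obtain ⟨w, b₁⟩ := y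
  have hangle (w : Word n) (b₁ : Bool) := run_angleCircuit O i w c p b₀ b₁ (decide (c = p))
    (entryNums f g (if c = p then 1 else 0) α S) rfl rfl rfl rfl
  have hfin (w : Word n) (b₁ : Bool) : Circuit.run O (Circuit.adj angleCircuit ++
      [.numUn true .copy 2 7 (by decide)] ++ Circuit.adj (entryCircuit f g ν))
      (ket (conf i w c p b₀ b₁ (decide (c = p))
        (angleNums (entryNums f g (if c = p then 1 else 0) α S)))) =
      ket (idle i c b₀ (S - weight c p α) (w, b₁)) := by
    rw [run_append, run_append, ← hangle, run_adj_run O isPhase_angleCircuit, run_numUn_copy,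
      ← run_entryCircuit O f g hpos hval, run_adj_run O (isPhase_entryCircuit f g ν)]
    simp [addOrSub, weight, idle]
  rw [stepCircuit, run_append O (_ ++ moveCircuit), run_append O (_ ++ angleCircuit),
    run_append O (entryCircuit f g ν), run_entryCircuit O f g hpos hval, hangle,
    run_moveCircuit]
  dsimp only
  by_cases hw : (if b₁ then w - p else w) = 0
  · rw [if_pos hw, if_pos hw, map_sum]
    refine Finset.sum_congr rfl fun o _ => ?_
    rw [map_smul, hfin]
    rfl
  · rw [if_neg hw, if_neg hw, hfin]

lemma run_restoreCircuit (O : Oracle n) (f g : UnOp) {ν : ℕ} {c p : Word n} {α : ℂ}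
    (hpos : O.pos (c, word n ν) = (c, p)) (hval : ∀ z, O.val (c, p, z) = (c, p, z + α))
    (i : Word n) (b₀ : Bool) (S : ℝ) (y : Word n × Bool) :
    Circuit.run O (restoreCircuit f g ν) (ket (idle i c b₀ S y)) =
      ket (idle i c b₀ (S + weight c p α) y) := by
  rw [restoreCircuit, run_append, run_append, run_entryCircuit O f g hpos hval, run_numUn_copy,
    ← run_entryCircuit O f g hpos hval, run_adj_run O (isPhase_entryCircuit f g ν)]
  simp [addOrSub, weight, idle]

/-! ### The whole row -/

/-- The oracle `O` returns the distinct positions `p 0, …, p (d - 1)` and the values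
`α 0, …, α (d - 1)` for the row `c`. -/
structure RowAccess (O : Oracle n) (d : ℕ) (c : Word n) (p : ℕ → Word n) (α : ℕ → ℂ) : Prop where
  pos : ∀ ν < d, O.pos (c, word n ν) = (c, p ν)
  val : ∀ ν < d, ∀ z, O.val (c, p ν, z) = (c, p ν, z + α ν)
  inj : ∀ ν < d, ∀ ν' < d, p ν = p ν' → ν = ν'

/-- The weight that is left after `k` steps. -/
def residual (c : Word n) (p : ℕ → Word n) (α : ℕ → ℂ) (k : ℕ) : ℝ :=
  1 - ∑ ν ∈ Finset.range k, weight c (p ν) (α ν)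

lemma residual_succ (c : Word n) (p : ℕ → Word n) (α : ℕ → ℂ) (k : ℕ) :
    residual c p α (k + 1) = residual c p α k - weight c (p k) (α k) := by
  rw [residual, residual, Finset.sum_range_succ]; ring

/-- Superpositions of idle memories. -/
def idles (i c : Word n) (b₀ : Bool) (S : ℝ) : Submodule ℂ (State n) :=
  Submodule.span ℂ (Set.range fun y => ket (idle i c b₀ S y))

lemma ket_idle_mem (i c : Word n) (b₀ : Bool) (S : ℝ) (y : Word n × Bool) :
    ket (idle i c b₀ S y) ∈ idles i c b₀ S :=
  Submodule.subset_span ⟨y, rfl⟩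

section

variable {O : Oracle n} {d : ℕ} {c : Word n} {p : ℕ → Word n} {α : ℕ → ℂ}

/-- Unitarity concerns arbitrary initial contents `y` of the second register, not only the one from
which the state is prepared. -/
lemma run_steps_mem (h : RowAccess O d c p α) (f g : UnOp) (i : Word n) (b₀ : Bool)
    (y : Word n × Bool) {k : ℕ} (hk : k ≤ d) :
    Circuit.run O ((List.range k).flatMap (stepCircuit f g)) (ket (idle i c b₀ 1 y)) ∈
      idles i c b₀ (residual c p α k) := by
  induction k with
  | zero => simpa [residual] using ket_idle_mem i c b₀ 1 y
  | succ k ih =>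
    rw [List.range_succ, List.flatMap_append, run_append, List.flatMap_singleton]
    have hle : idles i c b₀ (residual c p α k) ≤
        (idles i c b₀ (residual c p α (k + 1))).comap (Circuit.run O (stepCircuit f g k)) := by
      refine Submodule.span_le.2 ?_
      rintro _ ⟨y, rfl⟩
      rw [SetLike.mem_coe, Submodule.mem_comap, run_stepCircuit O f g (h.pos k hk) (h.val k hk),
        residual_succ]
      by_cases hw : (if y.2 then y.1 - p k else y.1) = 0
      · rw [if_pos hw]
        exact Submodule.sum_mem _ fun o _ => Submodule.smul_mem _ _ (ket_idle_mem _ _ _ _ _)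
      · rw [if_neg hw]
        exact ket_idle_mem _ _ _ _ _
    exact Submodule.mem_comap.1 (hle (ih (by omega)))

lemma run_steps_zero (h : RowAccess O d c p α) {f g : UnOp}
    (hfg : ∀ z, ‖g.eval (f.eval z)‖ = √‖z‖) (hres : 0 ≤ residual c p α d)
    (i : Word n) (b₀ : Bool) {k : ℕ} (hk : k ≤ d) :
    Circuit.run O ((List.range k).flatMap (stepCircuit f g)) (ket (idle i c b₀ 1 (0, false))) =
      ∑ ν ∈ Finset.range k, amplitude f g c (p ν) (α ν) •
        ket (idle i c b₀ (residual c p α k) (p ν, true)) +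
      ((√(residual c p α k) : ℝ) : ℂ) • ket (idle i c b₀ (residual c p α k) (0, false)) := by
  induction k with
  | zero => simp [residual]
  | succ k ih =>
    rw [List.range_succ, List.flatMap_append, run_append, List.flatMap_singleton, ih (by omega),
      map_add, map_sum, Finset.sum_range_succ, add_assoc]
    refine congrArg₂ (· + ·) ?_ ?_
    · refine Finset.sum_congr rfl fun ν hν => ?_
      have hν := Finset.mem_range.1 hν
      -- An earlier deposit sits at a different position, hence outside the plane of the current
      -- rotation.
      have hne : p ν - p k ≠ 0 := fun e =>
        hν.ne (h.inj ν (by omega) k (by omega) (sub_eq_zero.1 e))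
      rw [map_smul, run_stepCircuit O f g (h.pos k hk) (h.val k hk), residual_succ]
      simp [hne]
    · have hw : 0 ≤ weight c (p k) (α k) := norm_nonneg _
      -- Residuals decrease, so non-negativity after the last step gives $t\le S$ at every step.
      have hanti : residual c p α d ≤ residual c p α (k + 1) :=
        sub_le_sub_left (Finset.sum_le_sum_of_subset_of_nonneg
          (Finset.range_mono hk) fun _ _ _ => norm_nonneg _) _
      have hS : weight c (p k) (α k) ≤ residual c p α k := by
        rw [residual_succ] at hanti; linarith
      rw [map_smul, run_stepCircuit O f g (h.pos k hk) (h.val k hk), residual_succ]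
      simp only [Bool.false_eq_true, if_false, if_true, Fintype.sum_bool, smul_add, smul_smul]
      congr 2
      · rw [twistedRotation_true_false, mul_left_comm, ← Complex.ofReal_sin, ← Complex.ofReal_mul,
          sqrt_mul_sin_splitAngle hw hS]
        have := exp_arg_sqrt_sq (amplitude f g c (p k) (α k))
        rwa [show ‖amplitude f g c (p k) (α k)‖ = √(weight c (p k) (α k)) from hfg _] at this
      · rw [twistedRotation_false_false, ← Complex.ofReal_cos, ← Complex.ofReal_mul,
          sqrt_mul_cos_splitAngle hw hS]

lemma run_restores (h : RowAccess O d c p α) (f g : UnOp) (i : Word n) (b₀ : Bool) (S : ℝ)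
    (y : Word n × Bool) {k : ℕ} (hk : k ≤ d) :
    Circuit.run O ((List.range k).flatMap (restoreCircuit f g)) (ket (idle i c b₀ S y)) =
      ket (idle i c b₀ (S + ∑ ν ∈ Finset.range k, weight c (p ν) (α ν)) y) := by
  induction k with
  | zero => simp
  | succ k ih =>
    rw [List.range_succ, List.flatMap_append, run_append, List.flatMap_singleton, ih (by omega),
      run_restoreCircuit O f g (h.pos k hk) (h.val k hk), Finset.sum_range_succ, add_assoc]

end

/-! ### The state preparation circuit -/

/-- `i` if `i < N`, and `0` otherwise -/
def clamp (N : ℕ) (i : Word n) : Word n := if word n (N - 1) < i then 0 else i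

/-- Compute the clamped label, and initialise the residual weight. -/
def clampCircuit (N : ℕ) : Circuit n :=
  [.idxConst (word n (N - 1)) 3, .idxLt 3 0 2, .idxAdd false 0 2 (by decide),
    .cIdxAdd true 2 0 2 (by decide), .idxLt 3 0 2, .idxConst (-word n (N - 1)) 3, .numConst 1 7]

lemma run_clampCircuit (O : Oracle n) (N : ℕ) (i : Word n) (b₀ : Bool) (y : Word n × Bool) :
    Circuit.run O (clampCircuit N) (ket (idle i 0 b₀ 0 y)) = ket (idle i (clamp N i) b₀ 1 y) := by
  simp only [clampCircuit, run_cons_ket, Gate.onBasis, run_nil]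
  congr 1
  by_cases h : word n (N - 1) < i
  · ext k
    · rcases k with _ | _ | _ | _ | k <;> simp [conf, addOrSub, clamp, h]
    · rcases k with _ | _ | _ | _ | k <;> simp [conf, h]
    · rcases k with _ | _ | _ | _ | _ | _ | _ | _ | k <;> simp [conf, residualNums, h]
  · ext k
    · rcases k with _ | _ | _ | _ | k <;> simp [conf, addOrSub, clamp, h]
    · rcases k with _ | _ | _ | _ | k <;> simp [conf, h]
    · rcases k with _ | _ | _ | _ | _ | _ | _ | _ | k <;> simp [conf, residualNums, h]

/-- Prepare the state with amplitudes `amplitude f g` in the second register. -/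
def rowCircuit (N d : ℕ) (f g : UnOp) : Circuit n :=
  clampCircuit N ++ (List.range d).flatMap (stepCircuit f g) ++
    ((List.range d).flatMap (restoreCircuit f g) ++ Circuit.adj (clampCircuit N) ++
      [.single 1 pauliX])

lemma isPhase_clampCircuit (N : ℕ) : ∀ x ∈ (clampCircuit N : Circuit n), x.isPhase = false := by
  simp [clampCircuit, Gate.isPhase]

lemma isPhase_rowCircuit (N d : ℕ) (f g : UnOp) :
    ∀ x ∈ (rowCircuit N d f g : Circuit n), x.isPhase = false := by
  have h1 := isPhase_clampCircuit (n := n) N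
  have h2 := isPhase_entryCircuit (n := n) f g
  have h3 := isPhase_angleCircuit (n := n)
  have h4 : ∀ x ∈ (moveCircuit : Circuit n), x.isPhase = false := by
    simp [moveCircuit, twistedRotationCircuit, Gate.isPhase]
  intro x hx
  simp only [rowCircuit, stepCircuit, restoreCircuit, List.mem_append, List.mem_flatMap,
    List.mem_singleton] at hx
  rcases hx with (hx | ⟨ν, -, ((hx | hx) | hx) | (hx | hx) | hx⟩) | (⟨ν, -, (hx | hx) | hx⟩ | hx) | hx
  all_goals first
    | exact h1 x hx
    | exact h2 _ x hx
    | exact h3 x hx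
    | exact h4 x hx
    | exact isPhase_adj h1 x hx
    | exact isPhase_adj (h2 _) x hx
    | exact isPhase_adj h3 x hx
    | (subst hx; rfl)

/-- Each entry costs 78 for its step and at most 72 for its restoration (a generous figure);
$29=7+3\cdot 7+1$ accounts for clamping, its inverse and the final $X$. -/
lemma length_rowCircuit (N d : ℕ) (f g : UnOp) :
    (rowCircuit N d f g : Circuit n).length ≤ 150 * d + 29 := by
  have h1 : (Circuit.adj (clampCircuit N) : Circuit n).length ≤ 3 * 7 := length_adj_le _
  have h2 (ν : ℕ) : (Circuit.adj (entryCircuit f g ν) : Circuit n).length ≤ 3 * 11 :=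
    length_adj_le _
  have h3 : (Circuit.adj angleCircuit : Circuit n).length ≤ 3 * 5 := length_adj_le _
  have h4 (ν : ℕ) : (stepCircuit f g ν : Circuit n).length ≤ 78 := by
    have := h2 ν
    simp only [stepCircuit, List.length_append, List.length_cons, List.length_nil, moveCircuit,
      twistedRotationCircuit, entryCircuit, angleCircuit] at this h3 ⊢
    omega
  have h5 (ν : ℕ) : (restoreCircuit f g ν : Circuit n).length ≤ 72 := by
    have := h2 ν
    simp only [restoreCircuit, List.length_append, List.length_cons, List.length_nil,
      entryCircuit] at this ⊢
    omega
  have h6 (F : ℕ → Circuit n) (b : ℕ) (hF : ∀ ν, (F ν).length ≤ b) :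
      ((List.range d).flatMap F).length ≤ d * b := by
    induction d with
    | zero => simp
    | succ k ih =>
      rw [List.range_succ, List.flatMap_append, List.length_append, List.flatMap_singleton, add_mul]
      have := hF k
      omega
  have h7 := h6 _ _ h4
  have h8 := h6 _ _ h5
  simp only [rowCircuit, List.length_append, List.length_cons, List.length_nil,
    clampCircuit] at h1 ⊢
  omega

lemma load_eq_idle (i : Word n) (b₀ : Bool) (y : Word n × Bool) :
    load ((b₀, y), i) = idle i 0 b₀ 0 y := by
  have hw : word n 0 = 0 := rfl
  ext k
  · rcases k with _ | _ | _ | _ | k <;> simp [load, conf, reg₁, reg₂, hw]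
  · rcases k with _ | _ | _ | _ | k <;> simp [load, conf, reg₁, reg₂]
  · rcases k with _ | _ | _ | _ | _ | _ | _ | _ | k <;> simp [load, conf, residualNums]

section

variable {O : Oracle n} {N d : ℕ} {i : Word n} {p : ℕ → Word n} {α : ℕ → ℂ}

/-- Adding the weights back gives residual weight $1$, which the inverse of `clampCircuit` clears.
The last $X$ reconciles two conventions: during the steps the flag $1$ marks deposited weight,
whereas in a `Label` it marks $\bot$. -/
lemma run_rowCircuit_tail (h : RowAccess O d (clamp N i) p α) (f g : UnOp) (b₀ : Bool)
    (y : Word n × Bool) :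
    Circuit.run O ((List.range d).flatMap (restoreCircuit f g) ++ Circuit.adj (clampCircuit N) ++
      [.single 1 pauliX]) (ket (idle i (clamp N i) b₀ (residual (clamp N i) p α d) y)) =
      ket (load ((b₀, (y.1, !y.2)), i)) := by
  rw [run_append, run_append, run_restores h f g i b₀ _ y le_rfl, residual, sub_add_cancel,
    ← run_clampCircuit O, run_adj_run O (isPhase_clampCircuit N), run_cons_ket, run_nil,
    load_eq_idle]
  have hset (o : Bool) : (idle i 0 b₀ 0 y).setBit 1 o = idle i 0 b₀ 0 (y.1, o) := by
    ext k
    · rfl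
    · rcases k with _ | _ | _ | _ | k <;> simp [conf]
    · rfl
  obtain ⟨w, b⟩ := y
  simp only [Gate.onBasis, applyQubit, hset, Fintype.sum_bool, pauliX, Matrix.of_apply]
  cases b <;> simp [conf]

lemma run_rowCircuit_mem (h : RowAccess O d (clamp N i) p α) (f g : UnOp) (b₀ : Bool)
    (y : Word n × Bool) :
    Circuit.run O (rowCircuit N d f g) (ket (load ((b₀, y), i))) ∈ loads n := by
  rw [rowCircuit, run_append O (clampCircuit N ++ _), run_append O (clampCircuit N), load_eq_idle, run_clampCircuit]
  have hle : idles i (clamp N i) b₀ (residual (clamp N i) p α d) ≤ (loads n).comap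
      (Circuit.run O ((List.range d).flatMap (restoreCircuit f g) ++
        Circuit.adj (clampCircuit N) ++ [.single 1 pauliX])) := by
    refine Submodule.span_le.2 ?_
    rintro _ ⟨y, rfl⟩
    rw [SetLike.mem_coe, Submodule.mem_comap, run_rowCircuit_tail h]
    exact Submodule.subset_span ⟨_, rfl⟩
  exact Submodule.mem_comap.1 (hle (run_steps_mem h f g i b₀ y le_rfl))

lemma run_rowCircuit_zero (h : RowAccess O d (clamp N i) p α) {f g : UnOp}
    (hfg : ∀ z, ‖g.eval (f.eval z)‖ = √‖z‖) (hres : 0 ≤ residual (clamp N i) p α d) :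
    Circuit.run O (rowCircuit N d f g) (ket (load (ancZero n, i))) =
      ∑ ν ∈ Finset.range d, amplitude f g (clamp N i) (p ν) (α ν) •
        ket (load ((false, (p ν, false)), i)) +
      ((√(residual (clamp N i) p α d) : ℝ) : ℂ) • ket (load ((false, lastLabel n), i)) := by
  rw [rowCircuit, run_append O (clampCircuit N ++ _), run_append O (clampCircuit N), ancZero, load_eq_idle, run_clampCircuit]
  have h1 := run_steps_zero h hfg hres i false le_rfl
  rw [show ((word n 0, false) : Word n × Bool) = (0, false) from rfl, h1, map_add, map_sum]
  simp only [map_smul, run_rowCircuit_tail h]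
  rfl

end

/-! ### The rows of the matrix -/

lemma word_val {i : ℕ} (h : i < 2 ^ n) : (word n i).val = i := Nat.mod_eq_of_lt h

lemma word_fin_injective {N : ℕ} (hN : N ≤ 2 ^ n) :
    Function.Injective fun i : Fin N => word n i := fun i j h => Fin.ext <| by
  have := congrArg Fin.val h
  simpa only [word_val (i.2.trans_le hN), word_val (j.2.trans_le hN)] using this

/-- The label stored in a word, or `0` if the word is not a label. -/
def rowOf {N : ℕ} (hN0 : 0 < N) (i : Word n) : Fin N :=
  if h : i.val < N then ⟨i, h⟩ else ⟨0, hN0⟩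

lemma rowOf_word {N : ℕ} (hN0 : 0 < N) (hN : N ≤ 2 ^ n) (i : Fin N) :
    rowOf hN0 (word n i) = i := by
  simp [rowOf, word_val (i.2.trans_le hN)]

lemma clamp_eq {N : ℕ} (hN0 : 0 < N) (hN : N ≤ 2 ^ n) (i : Word n) :
    clamp N i = word n (rowOf hN0 i) := by
  -- The threshold is $N-1$ because $N$ itself does not fit into a word when $N=2^n$.
  have h1 : word n (N - 1) < i ↔ ¬ i.val < N := by
    rw [Fin.lt_def, word_val (by omega)]; omega
  by_cases h : i.val < N
  · rw [clamp, if_neg (by simpa [h1] using h), rowOf, dif_pos h]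
    exact Fin.ext (word_val i.2).symm
  · rw [clamp, if_pos (h1.2 h), rowOf, dif_neg h]
    rfl

open Classical in
/-- The state with amplitudes `g (f (δ_rl - A_rl))`. -/
def rowState {N : ℕ} (n : ℕ) (f g : UnOp) (A : Matrix (Fin N) (Fin N) ℂ) (r : Fin N) :
    Label n → ℂ :=
  (∑ l with A r l ≠ 0, g.eval (f.eval ((if r = l then 1 else 0) - A r l)) •
      Pi.single (label n l) 1)
    + ((√(rest A r) : ℝ) : ℂ) • Pi.single (lastLabel n) 1

lemma conj_psi {N : ℕ} (A : Matrix (Fin N) (Fin N) ℂ) (r : Fin N) (y : Label n) :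
    (starRingEnd ℂ) (psi n A r y) = rowState n .sqrt .conj A r y := by
  simp only [psi, rowState, Pi.add_apply, Finset.sum_apply, Pi.smul_apply, smul_eq_mul, map_add,
    map_sum, map_mul, UnOp.eval, Complex.conj_ofReal, Pi.single_apply, apply_ite (starRingEnd ℂ),
    map_one, map_zero]

lemma phi_eq {N : ℕ} (A : Matrix (Fin N) (Fin N) ℂ) (r : Fin N) :
    phi n A r = rowState n .conj .sqrt A r := by
  simp only [phi, rowState, UnOp.eval, map_sub, apply_ite (starRingEnd ℂ), map_one, map_zero]

section

variable {N : ℕ} {A : Matrix (Fin N) (Fin N) ℂ} {f g : UnOp}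

lemma eval_zero (hfg : ∀ z, ‖g.eval (f.eval z)‖ = √‖z‖) : g.eval (f.eval 0) = 0 := by
  simpa using hfg 0

-- Outside the support $\delta_{rl}-A_{rl}$ vanishes except possibly at $l=r$, and `hA` puts the
-- diagonal into the support.
open Classical in
lemma rowState_eq_sum (hfg : ∀ z, ‖g.eval (f.eval z)‖ = √‖z‖) {r : Fin N} (hA : A r r ≠ 0) :
    rowState n f g A r =
      (∑ l, g.eval (f.eval ((if r = l then 1 else 0) - A r l)) • Pi.single (label n l) 1)
        + ((√(rest A r) : ℝ) : ℂ) • Pi.single (lastLabel n) 1 := by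
  rw [rowState, Finset.sum_filter_of_ne]
  intro l _ hl h0
  refine hl ?_
  have : r ≠ l := by rintro rfl; exact hA h0
  rw [h0, if_neg this, sub_zero, eval_zero hfg, zero_smul]

lemma rowState_apply (hN : N ≤ 2 ^ n) (hfg : ∀ z, ‖g.eval (f.eval z)‖ = √‖z‖) {r : Fin N}
    (hA : A r r ≠ 0) (w : Word n) :
    rowState n f g A r (w, false) =
      if h : w.val < N then g.eval (f.eval ((if r = ⟨w, h⟩ then 1 else 0) - A r ⟨w, h⟩)) else 0 := by
  classical
  rw [rowState_eq_sum hfg hA]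
  have h0 : ((w, false) : Label n) ≠ lastLabel n := by simp [lastLabel]
  simp only [Pi.add_apply, Finset.sum_apply, Pi.smul_apply, smul_eq_mul, Pi.single_apply, h0,
    if_false, mul_zero, add_zero, mul_ite, mul_one]
  by_cases h : w.val < N
  · rw [dif_pos h, Finset.sum_eq_single ⟨w, h⟩]
    · have hw : word n w.val = w := Fin.ext (word_val w.2)
      rw [if_pos]
      rw [label, hw]
    · intro l _ hl
      rw [if_neg]
      intro e
      refine hl (Fin.ext ?_)
      have := congrArg (fun y : Label n => y.1.val) e
      simpa [label, word_val (l.2.trans_le hN)] using this.symm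
    · simp
  · rw [dif_neg h]
    refine Finset.sum_eq_zero fun l _ => if_neg fun e => h ?_
    have := congrArg (fun y : Label n => y.1.val) e
    simp only [label, word_val (l.2.trans_le hN)] at this
    omega

/-! ### Positive definite, diagonally dominant matrices -/

lemma diag_pos (hA : A.PosDef) (r : Fin N) : 0 < A r r := hA.diag_pos

lemma diag_eq_re (hA : A.PosDef) (r : Fin N) : A r r = ((A r r).re : ℝ) := by
  have := (Complex.pos_iff.1 (diag_pos hA r)).2
  exact Complex.ext rfl this.symm

lemma rest_nonneg (hA : A.PosDef) (hdom : IsDiagDominant A) (r : Fin N) : 0 ≤ rest A r := by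
  have h := hdom r
  rw [diag_eq_re hA r, Complex.norm_real, Real.norm_of_nonneg
    (Complex.pos_iff.1 (diag_pos hA r)).1.le] at h
  exact sub_nonneg.2 h

/-- The diagonal term is $1-A_{rr}$ without modulus, precisely because $A_{rr}\le 1$. Consequently
the weight left after all steps is $r_r$, the weight of $\bot$. -/
lemma sum_norm_sub (hA : A.PosDef) (hle : ∀ i, (A i i).re ≤ 1) (r : Fin N) :
    ∑ l, ‖(if r = l then 1 else 0) - A r l‖ = 1 - rest A r := by
  rw [← Finset.add_sum_erase _ _ (Finset.mem_univ r), rest]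
  have h1 : ‖(if r = r then 1 else 0) - A r r‖ = 1 - (A r r).re := by
    rw [if_pos rfl, diag_eq_re hA r, ← Complex.ofReal_one, ← Complex.ofReal_sub, Complex.norm_real,
      Real.norm_of_nonneg (sub_nonneg.2 (hle r)), Complex.ofReal_re]
  have h2 : ∑ l ∈ Finset.univ.erase r, ‖(if r = l then 1 else 0) - A r l‖ =
      ∑ l ∈ Finset.univ.erase r, ‖A r l‖ :=
    Finset.sum_congr rfl fun l hl => by
      rw [if_neg (Finset.ne_of_mem_erase hl).symm, zero_sub, norm_neg]
  rw [h1, h2]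
  ring

/-! ### The state preparation unitaries -/

theorem exists_rowUnitary {d : ℕ} (hN0 : 0 < N) (hN : N ≤ 2 ^ n) (hdN : d ≤ N)
    (hfg : ∀ z, ‖g.eval (f.eval z)‖ = √‖z‖) (hA : A.PosDef) (hdom : IsDiagDominant A)
    (hle : ∀ i, (A i i).re ≤ 1) {O : Oracle n} (hO : IsSparseAccess O A d) :
    ∃ U ∈ Matrix.unitaryGroup (Anc n × Word n) ℂ,
      Implements O (rowCircuit N d f g) U ∧
      Implements O (Circuit.adj (rowCircuit N d f g)) Uᴴ ∧
      ∀ i y, U y (ancZero n, i) =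
        (if reg₁ y = (i, false) then 1 else 0) * rowState n f g A (rowOf hN0 i) (reg₂ y) := by
  classical
  obtain ⟨⟨j, hj, hsupp⟩, hval⟩ := hO
  have hwN := word_fin_injective hN
  have hwd (ν ν' : Fin d) (h : word n ν = word n ν') : ν = ν' :=
    word_fin_injective (hdN.trans hN) h
  -- Distinctness of the listed positions comes from reversibility of the position oracle.
  have hjinj (r : Fin N) : Function.Injective (j r) := fun ν ν' h => by
    have h1 : O.pos (word n r, word n ν) = O.pos (word n r, word n ν') := by rw [hj, hj, h]
    exact hwd ν ν' (Prod.ext_iff.1 (O.pos.injective h1)).2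
  let p (r : Fin N) (ν : ℕ) : Word n := if h : ν < d then word n (j r ⟨ν, h⟩) else 0
  let α (r : Fin N) (ν : ℕ) : ℂ := if h : ν < d then A r (j r ⟨ν, h⟩) else 0
  have hrow (r : Fin N) : RowAccess O d (word n r) (p r) (α r) :=
    { pos := fun ν hν => by simpa [p, hν] using hj r ⟨ν, hν⟩
      val := fun ν hν z => by simpa [p, α, hν] using hval r (j r ⟨ν, hν⟩) z
      inj := fun ν hν ν' hν' h => by
        simp only [p, hν, hν', dif_pos] at h
        exact congrArg Fin.val (hjinj r (hwN h)) }
  have hne (r : Fin N) : A r r ≠ 0 := (diag_pos hA r).ne'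
  have hdelta (r l : Fin N) : (if word n r = word n l then (1 : ℂ) else 0) =
      if r = l then 1 else 0 := if_congr hwN.eq_iff rfl rfl
  have hout (r l : Fin N) (hl : l ∉ Set.range (j r)) : (if r = l then (1 : ℂ) else 0) - A r l = 0 := by
    have h0 : A r l = 0 := by
      by_contra h0
      exact hl (hsupp r l h0)
    have : r ≠ l := by rintro rfl; exact hne _ h0
    rw [h0, if_neg this, sub_zero]
  have hres (r : Fin N) : residual (word n r) (p r) (α r) d = rest A r := by
    -- Unlisted columns have weight zero by `hout`, so the sum over the list is the sum over the
    -- whole row.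
    rw [residual, Finset.sum_range, Fintype.sum_of_injective (j r) (hjinj r) _
      (fun l => ‖(if r = l then (1 : ℂ) else 0) - A r l‖) (fun l hl => by rw [hout r l hl, norm_zero])
      (fun ν => by simp [weight, p, α, hdelta]), sum_norm_sub hA hle]
    ring
  have hrow' (i : Word n) := clamp_eq hN0 hN i ▸ hrow (rowOf hN0 i)
  obtain ⟨U, hU, hUc, hUa⟩ := exists_unitary_implements O (isPhase_rowCircuit N d f g)
    fun ⟨⟨b₀, y⟩, i⟩ => run_rowCircuit_mem (hrow' i) f g b₀ y
  refine ⟨U, hU, hUc, hUa, fun i y => ?_⟩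
  have hr := clamp_eq hN0 hN i
  rw [hUc.apply, run_rowCircuit_zero (hrow' i) hfg
    (by rw [hr, hres]; exact rest_nonneg hA hdom _), hr, hres, rowState_eq_sum hfg (hne _),
    Finset.sum_range, Fintype.sum_of_injective (j (rowOf hN0 i)) (hjinj _) _
      (fun l => g.eval (f.eval ((if rowOf hN0 i = l then (1 : ℂ) else 0) - A (rowOf hN0 i) l)) •
        ket (load ((false, label n l), i)))
      (fun l hl => by rw [hout _ l hl, eval_zero hfg, zero_smul])
      (fun ν => by simp [amplitude, p, α, hdelta, label])]
  have hket (l : Label n) : ket (load ((false, l), i)) (load y) =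
      (if reg₁ y = (i, false) then 1 else 0) * (Pi.single l 1 : Label n → ℂ) (reg₂ y) := by
    obtain ⟨⟨b, y⟩, k⟩ := y
    have hiff : ((false, l), i) = ((b, y), k) ↔
        reg₁ ((b, y), k) = (i, false) ∧ reg₂ ((b, y), k) = l := by
      simp only [reg₁, reg₂, Prod.mk.injEq]
      tauto
    rw [ket_load_apply, Pi.single_apply, if_congr hiff rfl rfl, ite_and, ite_mul, one_mul,
      zero_mul]
  simp only [Finsupp.add_apply, Finsupp.finsetSum_apply, Finsupp.smul_apply, hket, Pi.add_apply,
    Finset.sum_apply, Pi.smul_apply, smul_eq_mul, mul_add, Finset.mul_sum]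
  refine congrArg₂ (· + ·) (Finset.sum_congr rfl fun l _ => ?_) ?_ <;> ring

end

/-! ### Exchanging the two registers -/

/-- Exchange the two registers of `n + 1` qubits. -/
def swapCircuit : Circuit n :=
  [.idxSwap 0 1, .cnot 0 1 (by decide), .cnot 1 0 (by decide), .cnot 0 1 (by decide)]

/-- The exchange of the two registers on basis states. -/
def swapRegs (x : Anc n × Word n) : Anc n × Word n := ((x.1.2.2, (x.2, x.1.1)), x.1.2.1)

lemma run_swapCircuit (O : Oracle n) (x : Anc n × Word n) :
    Circuit.run O swapCircuit (ket (load x)) = ket (load (swapRegs x)) := by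
  obtain ⟨⟨a, w, b⟩, i⟩ := x
  simp only [swapCircuit, run_cons_ket, Gate.onBasis, run_nil]
  congr 1
  ext k
  · rcases k with _ | _ | k <;> simp [load, reg₁, reg₂, swapRegs]
  · rcases k with _ | _ | k <;> cases a <;> cases b <;> simp [load, reg₁, reg₂, swapRegs]
  · rfl

/-- The row circuit leaves the label in the first register and the state in the second; for $U_R$
they must be interchanged. -/
lemma exists_swapUnitary (O : Oracle n) :
    ∃ P ∈ Matrix.unitaryGroup (Anc n × Word n) ℂ, Implements O swapCircuit P ∧
      ∀ (U : Matrix (Anc n × Word n) (Anc n × Word n) ℂ) (x y), (P * U) y x = U (swapRegs y) x := by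
  classical
  obtain ⟨P, hP, hPc, -⟩ := exists_unitary_implements O (c := swapCircuit)
    (by simp [swapCircuit, Gate.isPhase]) fun x => by
      rw [run_swapCircuit]; exact Submodule.subset_span ⟨_, rfl⟩
  refine ⟨P, hP, hPc, fun U x y => ?_⟩
  rw [Matrix.mul_apply, Finset.sum_eq_single (swapRegs y)]
  · rw [hPc.apply, run_swapCircuit, ket_load_apply, if_pos (show swapRegs (swapRegs y) = y from rfl),
      one_mul]
  · intro z _ hz
    rw [hPc.apply, run_swapCircuit, ket_load_apply, if_neg, zero_mul]
    rintro rfl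
    exact hz rfl
  · simp

/-! ### The block-encoding -/

/-- Conjugation follows the root for $U_L$ and precedes it for $U_R$; the two orders differ on the
negative axis. The preparation needs only the modulus, which is the same for both. -/
lemma norm_conj_sqrt (z : ℂ) : ‖UnOp.conj.eval (UnOp.sqrt.eval z)‖ = √‖z‖ := by
  rw [UnOp.eval, UnOp.eval, RCLike.norm_conj, ← norm_sqrt_sq z, Real.sqrt_sq (norm_nonneg _)]

lemma norm_sqrt_conj (z : ℂ) : ‖UnOp.sqrt.eval (UnOp.conj.eval z)‖ = √‖z‖ := by
  rw [UnOp.eval, UnOp.eval, ← RCLike.norm_conj z, ← norm_sqrt_sq ((starRingEnd ℂ) z), Real.sqrt_sq (norm_nonneg _)]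

theorem isBlockEncoding_of_rowStates {N : ℕ} (hN0 : 0 < N) (hN : N ≤ 2 ^ n)
    {A : Matrix (Fin N) (Fin N) ℂ} (hA : A.PosDef)
    {UL UR : Matrix (Anc n × Word n) (Anc n × Word n) ℂ}
    (hUL : UL ∈ Matrix.unitaryGroup (Anc n × Word n) ℂ)
    (hUR : UR ∈ Matrix.unitaryGroup (Anc n × Word n) ℂ)
    (hL : ∀ i y, UL y (ancZero n, i) =
      (if reg₁ y = (i, false) then 1 else 0) * rowState n .sqrt .conj A (rowOf hN0 i) (reg₂ y))
    (hR : ∀ j y, UR y (ancZero n, j) =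
      (if reg₂ y = (j, false) then 1 else 0) * rowState n .conj .sqrt A (rowOf hN0 j) (reg₁ y)) :
    IsBlockEncoding 1 (n + 2) 0 (ancZero n) (ULᴴ * UR) (padded n (1 - A)) := by
  refine ⟨?_, mul_mem (Unitary.star_mem hUL) hUR, ?_⟩
  · simp only [Fintype.card_prod, Fintype.card_bool, Fintype.card_fin]
    ring
  have hne (r : Fin N) : A r r ≠ 0 := (diag_pos hA r).ne'
  suffices h : padded n (1 - A) -
      ((1 : ℝ) : ℂ) • Matrix.of (fun i j => (ULᴴ * UR) (ancZero n, i) (ancZero n, j)) = 0 by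
    rw [h, map_zero, norm_zero]
  ext i j
  rw [Matrix.sub_apply, Matrix.smul_apply, Matrix.of_apply, Complex.ofReal_one, one_smul,
    Matrix.zero_apply, sub_eq_zero, Matrix.mul_apply, Finset.sum_eq_single ((false, (j, false)), i)]
  · rw [Matrix.conjTranspose_apply, hL, hR]
    simp only [reg₁, reg₂, if_true, one_mul]
    rw [rowState_apply hN norm_conj_sqrt (hne _), rowState_apply hN norm_sqrt_conj (hne _), padded,
      Matrix.of_apply]
    by_cases hi : i.val < N
    · by_cases hj : j.val < N
      · rw [dif_pos ⟨hi, hj⟩, dif_pos hi, dif_pos hj, rowOf, dif_pos hi, rowOf, dif_pos hj]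
        -- Hermitian symmetry makes the two roots equal, so their product is a square and the choice
        -- of branch does not matter.
        have hH : (starRingEnd ℂ) (A ⟨j, hj⟩ ⟨i, hi⟩) = A ⟨i, hi⟩ ⟨j, hj⟩ := hA.1.apply _ _
        simp only [UnOp.eval, RCLike.star_def, Complex.conj_conj, map_sub, hH,
          apply_ite (starRingEnd ℂ), map_one, map_zero]
        rw [if_congr (eq_comm (a := (⟨j, hj⟩ : Fin N))) rfl rfl, ← sq, sqrt_sq, Matrix.sub_apply,
          Matrix.one_apply]
      -- Row states have no amplitude on words that are not labels, which yields the zero padding.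
      · rw [dif_neg (by tauto), dif_neg hj, star_zero, zero_mul]
    · rw [dif_neg (by tauto), dif_neg hi, mul_zero]
  · rintro ⟨⟨b, y⟩, k⟩ - hne
    rw [Matrix.conjTranspose_apply, hL, hR]
    by_cases h1 : reg₁ ((b, y), k) = (i, false)
    · by_cases h2 : reg₂ ((b, y), k) = (j, false)
      · simp only [reg₁, reg₂, Prod.mk.injEq] at h1 h2
        exact absurd (by rw [h1.1, h1.2, h2]) hne
      · rw [if_neg h2, zero_mul, mul_zero]
    · rw [if_neg h1, zero_mul, star_zero, zero_mul]
  · simp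

end PDQLS

end

/-! ### Assembly of the three circuits -/

theorem mainTheorem6 :
    ∃ C : ℕ, ∀ N d n : ℕ, 0 < N → d ≤ N → n = Nat.clog 2 N →
      ∃ cL cR c : PDQLS.Circuit n,
        (∀ c' ∈ [cL, cR, c], c'.queries ≤ C * d ∧ c'.gates ≤ C * d) ∧
        ∀ A : Matrix (Fin N) (Fin N) ℂ,
          A.PosDef → PDQLS.IsDiagDominant A → (∀ i, (A i i).re ≤ 1) → PDQLS.IsSparse d A →
          ∀ O : PDQLS.Oracle n, PDQLS.IsSparseAccess O A d →
            ∃ UL UR : Matrix (PDQLS.Anc n × PDQLS.Word n) (PDQLS.Anc n × PDQLS.Word n) ℂ,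
              UL ∈ Matrix.unitaryGroup (PDQLS.Anc n × PDQLS.Word n) ℂ ∧
              UR ∈ Matrix.unitaryGroup (PDQLS.Anc n × PDQLS.Word n) ℂ ∧
              PDQLS.Implements O cL UL ∧ PDQLS.PreparesLeft A UL ∧
              PDQLS.Implements O cR UR ∧ PDQLS.PreparesRight A UR ∧
              PDQLS.Implements O c (ULᴴ * UR) ∧
              PDQLS.IsBlockEncoding 1 (n + 2) 0 (PDQLS.ancZero n) (ULᴴ * UR)
                (PDQLS.padded n (1 - A)) := by
  -- The longest circuit has length at most $(150d+33)+3(150d+29)=600d+120$, which is below $1000d$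
  -- once $d\ge 1$.
  refine ⟨1000, fun N d n hN0 hdN hn => ?_⟩
  have hN : N ≤ 2 ^ n := hn ▸ Nat.le_pow_clog one_lt_two N
  rcases Nat.eq_zero_or_pos d with rfl | hd
  · -- a positive definite matrix of positive size has a non-zero entry
    refine ⟨[], [], [], by simp [PDQLS.Circuit.queries, PDQLS.Circuit.gates], ?_⟩
    intro A hA _ _ hS
    have h := Nat.le_zero.1 (hS.1 ⟨0, hN0⟩)
    rw [Set.ncard_eq_zero] at h
    exact absurd h (Set.Nonempty.ne_empty ⟨⟨0, hN0⟩, (PDQLS.diag_pos hA _).ne'⟩)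
  let cL : PDQLS.Circuit n := PDQLS.rowCircuit N d .sqrt .conj
  let cR : PDQLS.Circuit n := PDQLS.rowCircuit N d .conj .sqrt ++ PDQLS.swapCircuit
  refine ⟨cL, cR, cR ++ PDQLS.Circuit.adj cL, ?_, ?_⟩
  · have hlen : ∀ c' ∈ [cL, cR, cR ++ PDQLS.Circuit.adj cL], c'.length ≤ 1000 * d := by
      have h1 : cL.length ≤ 150 * d + 29 := PDQLS.length_rowCircuit N d _ _
      have h2 : cR.length ≤ 150 * d + 33 := by
        have := PDQLS.length_rowCircuit (n := n) N d .conj .sqrt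
        rw [List.length_append]
        exact Nat.add_le_add_right this 4
      have h3 := PDQLS.length_adj_le cL
      simp only [List.mem_cons, List.not_mem_nil, or_false, forall_eq_or_imp, forall_eq,
        List.length_append]
      omega
    exact fun c' hc => ⟨List.countP_le_length.trans (hlen c' hc),
      List.countP_le_length.trans (hlen c' hc)⟩
  intro A hA hdom hle _ O hO
  obtain ⟨UL, hUL, hL, hLa, hLs⟩ :=
    PDQLS.exists_rowUnitary hN0 hN hdN PDQLS.norm_conj_sqrt hA hdom hle hO
  obtain ⟨V, hV, hVc, -, hVs⟩ :=
    PDQLS.exists_rowUnitary hN0 hN hdN PDQLS.norm_sqrt_conj hA hdom hle hO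
  obtain ⟨P, hP, hPc, hPs⟩ := PDQLS.exists_swapUnitary O
  have hRs : ∀ j y, (P * V) y (PDQLS.ancZero n, j) =
      (if PDQLS.reg₂ y = (j, false) then 1 else 0) *
        PDQLS.rowState n .conj .sqrt A (PDQLS.rowOf hN0 j) (PDQLS.reg₁ y) := fun j y => by
    rw [hPs, hVs]
    rfl
  have hR : PDQLS.Implements O cR (P * V) := hVc.append hPc
  refine ⟨UL, P * V, hUL, mul_mem hP hV, hL, fun i y => ?_, hR, fun j y => ?_, hR.append hLa,
    PDQLS.isBlockEncoding_of_rowStates hN0 hN hA hUL (mul_mem hP hV) hLs hRs⟩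
  · rw [hLs, PDQLS.rowOf_word hN0 hN, PDQLS.conj_psi]
    rfl
  · rw [hRs, PDQLS.rowOf_word hN0 hN, PDQLS.phi_eq, mul_comm]
    rfl
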